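/- **Theorem 4.1.** Let $n\ge 1$ and let $B_r=\{x\in\mathbb R^n:|x|<r\}$. Let $W\in L^\infty_{loc}(B_1\setminus\{0\})$ be real-valued with $W\ge 0$ a.e. on $B_1$. Assume that $W\notin L^1(U)$ for every neighborhood $U$ of $0$, and that $$\int_{B_r}\frac{1}{|x|^{n+2}W(x)}\,dx<\infty\quad\text{for some } r>0,$$ where the integrand is $+\infty$ wherever $W=0$. Let $w\in L^1_{loc}(B_1\setminus\{0\})$ be a real-valued weak solution of $-\Delta w=Ww$ on $B_1\setminus\{0\}$, that is, $$-\int_{B_1\setminus\{0\}} w\,\Delta\varphi\,dx=\int_{B_1\setminus\{0\}} W\,w\,\varphi\,dx\quad\text{for all }\varphi\in C_c^\infty(B_1\setminus\{0\}),$$ and suppose that $w=O(|x|^{2-n})$ near $0$, i.e. there are $C,\rho>0$ with $|w(x)|\le C|x|^{2-n}$ for a.e. $x\in B_\rho$. If $w\ge 0$ a.e. on $B_1$, or $w\le 0$ a.e. on $B_1$, then $w=0$ a.e. on $B_1$. -/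

import Mathlib

open MeasureTheory Filter Topology
open scoped ENNReal ContDiff Laplacian

/-- `f ∈ L^∞_loc(U)`: `f` is (a.e. strongly measurable and) essentially bounded on every
compact subset of `U`. -/
def MemLinftyLoc {n : ℕ} (f : EuclideanSpace ℝ (Fin n) → ℝ)
    (U : Set (EuclideanSpace ℝ (Fin n))) : Prop :=
  ∀ K : Set (EuclideanSpace ℝ (Fin n)), K ⊆ U → IsCompact K →
    MemLp f ∞ (volume.restrict K)

/-- `w` is a weak (distributional) solution of `-Δ w = W w` on `U`: tested against every smooth
function `φ` whose support is a compact subset of `U`. It is meant for `U` open and for `w` and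
`W w` locally integrable on `U`, so that both integrals converge. -/
def IsWeakSolution {n : ℕ} (W w : EuclideanSpace ℝ (Fin n) → ℝ)
    (U : Set (EuclideanSpace ℝ (Fin n))) : Prop :=
  ∀ φ : EuclideanSpace ℝ (Fin n) → ℝ, ContDiff ℝ ∞ φ → HasCompactSupport φ → tsupport φ ⊆ U →
    ∫ x in U, w x * (-(Δ φ) x) = ∫ x in U, W x * w x * φ x

/-! Up to replacing `w` by `-w`, one may assume `w ≥ 0`. Then `W w ≥ 0`, so `w` is weakly
superharmonic off the origin. Testing the equation with a cutoff equal to 1 on the annulus `1/T ≤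
|x| < 1/2` leaves an inner boundary term of order `T²` (Laplacian of the cutoff) times `T^(n-2)`
(growth of `w`) times `T^(-n)` (volume of the shell), hence bounded in `T`. So `W w` is integrable
near 0 (`IsWeakSolution.lintegral_potential_mul_lt_top`).

If `n ≥ 2`, the origin is removable: `w` is superharmonic on the whole ball
(`WeaklySuperharmonicOn.removable_singularity`). By the strong minimum principle, either `w = 0` or
`w ≥ c > 0` near 0. In the second case `W ≤ c⁻¹ W w` would be integrable near 0, contrary to
assumption.

If `n = 1`, the origin separates two intervals, and `w` is concave on each. On each interval it
either vanishes or is at least `c s` at distance `s` from 0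
(`eq_zero_or_linear_growth_of_superharmonic`). In the second case `s W` is integrable, as is `1 /
(s³ W)`; but their sum is at least `1 / s`, which is not integrable (`not_linear_growth`). -/

/-! ### Laplacians of radial functions and of products with them. -/

theorem laplacian_eq_sum_of_hasFDerivAt {E : Type*} [NormedAddCommGroup E] [InnerProductSpace ℝ E]
    [FiniteDimensional ℝ E] {ι : Type*} [Fintype ι] (v : OrthonormalBasis ι ℝ E)
    {f : E → ℝ} {f' : E → E →L[ℝ] ℝ} {f'' : E →L[ℝ] E →L[ℝ] ℝ} {x : E}
    (h1 : ∀ᶠ y in 𝓝 x, HasFDerivAt f (f' y) y) (h2 : HasFDerivAt f' f'' x) :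
    (Δ f) x = ∑ i, f'' (v i) (v i) := by
  have h : fderiv ℝ f =ᶠ[𝓝 x] f' := h1.mono fun y hy => hy.fderiv
  rw [InnerProductSpace.laplacian_eq_iteratedFDeriv_orthonormalBasis f v]
  simp [iteratedFDeriv_two_apply, h.fderiv_eq, h2.fderiv]

/-- The Laplacian of a product of a function with a radial function. -/
theorem laplacian_mul_radial {n : ℕ} {φ : EuclideanSpace ℝ (Fin n) → ℝ} {P P1 : ℝ → ℝ} {P2 : ℝ}
    {x x₀ : EuclideanSpace ℝ (Fin n)} (hφ : ContDiffAt ℝ 2 φ x)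
    (h1 : ∀ᶠ s in 𝓝 (‖x - x₀‖ ^ 2), HasDerivAt P (P1 s) s)
    (h2 : HasDerivAt P1 P2 (‖x - x₀‖ ^ 2)) :
    (Δ (fun y => φ y * P (‖y - x₀‖ ^ 2))) x =
      P (‖x - x₀‖ ^ 2) * (Δ φ) x + 4 * P1 (‖x - x₀‖ ^ 2) * fderiv ℝ φ x (x - x₀)
        + φ x * (4 * ‖x - x₀‖ ^ 2 * P2 + 2 * n * P1 (‖x - x₀‖ ^ 2)) := by
  set v := EuclideanSpace.basisFun (Fin n) ℝ with hv
  have hφ1 : ∀ᶠ y in 𝓝 x, HasFDerivAt φ (fderiv ℝ φ y) y := by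
    filter_upwards [hφ.eventually (by simp)] with y hy
    exact (hy.differentiableAt (by simp)).hasFDerivAt
  have hφ2 : HasFDerivAt (fderiv ℝ φ) (fderiv ℝ (fderiv ℝ φ) x) x :=
    ((hφ.fderiv_right (m := 1) (by norm_num)).differentiableAt (by simp)).hasFDerivAt
  set g : EuclideanSpace ℝ (Fin n) → ℝ := fun y => ‖y - x₀‖ ^ 2 with hg
  have hg1 : ∀ y, HasFDerivAt g ((2 : ℝ) • innerSL ℝ (y - x₀)) y := by
    intro y
    have := ((hasFDerivAt_id y).sub_const x₀).norm_sq
    refine this.congr_fderiv ?_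
    ext z
    simp [two_mul]
  have hgc : Tendsto g (𝓝 x) (𝓝 (g x)) := (hg1 x).continuousAt
  have hP : ∀ᶠ y in 𝓝 x, HasDerivAt P (P1 (g y)) (g y) := hgc.eventually h1
  have hg2 : HasFDerivAt (fun y : EuclideanSpace ℝ (Fin n) => (2 : ℝ) • innerSL ℝ (y - x₀))
      ((2 : ℝ) • (innerSL ℝ : EuclideanSpace ℝ (Fin n) →L[ℝ] _)) x := by
    have := ((innerSL ℝ : EuclideanSpace ℝ (Fin n) →L[ℝ] _).hasFDerivAt (x := x - x₀)).comp x
      ((hasFDerivAt_id x).sub_const x₀)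
    exact this.const_smul (2 : ℝ)
  have hPg : ∀ᶠ y in 𝓝 x, HasFDerivAt (fun y => P (g y))
      (P1 (g y) • ((2 : ℝ) • innerSL ℝ (y - x₀))) y := by
    filter_upwards [hP] with y hy
    exact hy.comp_hasFDerivAt y (hg1 y)
  have hP1g : HasFDerivAt (fun y => P1 (g y)) (P2 • ((2 : ℝ) • innerSL ℝ (x - x₀))) x :=
    h2.comp_hasFDerivAt x (hg1 x)
  have hF1 : ∀ᶠ y in 𝓝 x, HasFDerivAt (fun y => φ y * P (g y))
      (φ y • (P1 (g y) • ((2 : ℝ) • innerSL ℝ (y - x₀))) + P (g y) • fderiv ℝ φ y) y := by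
    filter_upwards [hPg, hφ1] with y h3 h4
    exact h4.mul h3
  have hF2 := (hφ1.self_of_nhds.smul (hP1g.smul hg2)).add (hPg.self_of_nhds.smul hφ2)
  rw [laplacian_eq_sum_of_hasFDerivAt v hF1 hF2]
  have hΔ : (Δ φ) x = ∑ i, fderiv ℝ (fderiv ℝ φ) x (v i) (v i) :=
    laplacian_eq_sum_of_hasFDerivAt v hφ1 hφ2
  have e1 : ∑ i, inner ℝ (x - x₀) (v i) * inner ℝ (x - x₀) (v i) = ‖x - x₀‖ ^ 2 := by
    rw [← real_inner_self_eq_norm_sq, ← v.sum_inner_mul_inner (x - x₀) (x - x₀)]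
    exact Finset.sum_congr rfl fun i _ => by rw [real_inner_comm (x - x₀) (v i)]
  have e2 : ∑ i, inner ℝ (x - x₀) (v i) * fderiv ℝ φ x (v i) = fderiv ℝ φ x (x - x₀) := by
    conv_rhs => rw [← v.sum_repr' (x - x₀)]
    simp only [map_sum, map_smul, smul_eq_mul]
    exact Finset.sum_congr rfl fun i _ => by rw [real_inner_comm (x - x₀) (v i)]
  have e3 : ∑ i : Fin n, inner ℝ (v i) (v i) = (n : ℝ) := by
    simp
  rw [hΔ, ← e1, ← e2]
  -- The identity holds coordinate by coordinate; only the summation uses `e1`, `e2` and `e3`.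
  trans ∑ i, (P (g x) * fderiv ℝ (fderiv ℝ φ) x (v i) (v i)
      + 4 * P1 (g x) * (inner ℝ (x - x₀) (v i) * fderiv ℝ φ x (v i))
      + φ x * (4 * (inner ℝ (x - x₀) (v i) * inner ℝ (x - x₀) (v i)) * P2
        + 2 * P1 (g x) * inner ℝ (v i) (v i)))
  · refine Finset.sum_congr rfl fun i _ => ?_
    simp only [add_apply, smul_apply,
      ContinuousLinearMap.smulRight_apply, innerSL_apply_apply, smul_eq_mul, Pi.smul_apply']
    rw [show (innerSL ℝ (v i)) (v i) = inner ℝ (v i) (v i) from rfl]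
    ring
  · rw [Finset.sum_add_distrib, Finset.sum_add_distrib, ← Finset.mul_sum, ← Finset.mul_sum,
      ← Finset.mul_sum, Finset.sum_add_distrib, ← Finset.sum_mul, ← Finset.mul_sum,
      ← Finset.mul_sum, e3]
    simp only [hg, e1]
    ring

/-- The Laplacian of a radial function. -/
theorem laplacian_radial {n : ℕ} {P P1 : ℝ → ℝ} {P2 : ℝ} {x x₀ : EuclideanSpace ℝ (Fin n)}
    (h1 : ∀ᶠ s in 𝓝 (‖x - x₀‖ ^ 2), HasDerivAt P (P1 s) s)
    (h2 : HasDerivAt P1 P2 (‖x - x₀‖ ^ 2)) :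
    (Δ (fun y => P (‖y - x₀‖ ^ 2))) x =
      4 * ‖x - x₀‖ ^ 2 * P2 + 2 * n * P1 (‖x - x₀‖ ^ 2) := by
  simpa using laplacian_mul_radial (φ := fun _ => 1) contDiffAt_const h1 h2

theorem continuous_laplacian {n : ℕ} {φ : EuclideanSpace ℝ (Fin n) → ℝ} (hφ : ContDiff ℝ ∞ φ) :
    Continuous (Δ φ) := by
  rw [InnerProductSpace.laplacian_eq_iteratedFDeriv_orthonormalBasis φ
    (EuclideanSpace.basisFun (Fin n) ℝ)]
  refine continuous_finsetSum _ fun i _ => ?_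
  have h : Continuous fun x => iteratedFDeriv ℝ 2 φ x :=
    hφ.continuous_iteratedFDeriv (m := 2) (WithTop.coe_le_coe.2 le_top)
  exact (continuous_eval_const _).comp h

theorem laplacian_eq_zero_of_notMem_tsupport {n : ℕ} {φ : EuclideanSpace ℝ (Fin n) → ℝ}
    {x : EuclideanSpace ℝ (Fin n)} (hx : x ∉ tsupport φ) : (Δ φ) x = 0 := by
  have h : φ =ᶠ[𝓝 x] fun _ => (0 : ℝ) := notMem_tsupport_iff_eventuallyEq.1 hx
  rw [(InnerProductSpace.laplacian_congr_nhds h).eq_of_nhds, InnerProductSpace.laplacian_const]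
  rfl

/-- A radial function with smooth profile in the squared radius is smooth. -/
theorem contDiff_radial {n : ℕ} {P : ℝ → ℝ} (hP : ContDiff ℝ ∞ P)
    (x₀ : EuclideanSpace ℝ (Fin n)) : ContDiff ℝ ∞ fun y => P (‖y - x₀‖ ^ 2) :=
  hP.comp ((contDiff_id.sub contDiff_const).norm_sq ℝ)

/-! ### The profile `expNegInvGlue` and its first two derivatives. -/

/-- The first derivative of `expNegInvGlue`. -/
noncomputable def glueDeriv (x : ℝ) : ℝ := x⁻¹ ^ 2 * expNegInvGlue x

/-- The second derivative of `expNegInvGlue`. -/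
noncomputable def glueDerivTwo (x : ℝ) : ℝ := (x⁻¹ ^ 4 - 2 * x⁻¹ ^ 3) * expNegInvGlue x

theorem hasDerivAt_expNegInvGlue (x : ℝ) : HasDerivAt expNegInvGlue (glueDeriv x) x := by
  simpa [glueDeriv] using expNegInvGlue.hasDerivAt_polynomial_eval_inv_mul 1 x

theorem hasDerivAt_glueDeriv (x : ℝ) : HasDerivAt glueDeriv (glueDerivTwo x) x := by
  have h := expNegInvGlue.hasDerivAt_polynomial_eval_inv_mul (Polynomial.X ^ 2) x
  refine (h.congr_deriv ?_).congr_of_eventuallyEq (Eventually.of_forall fun y => ?_)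
  · simp only [Polynomial.eval_mul, Polynomial.eval_pow, Polynomial.eval_X, Polynomial.eval_sub,
      Polynomial.derivative_X_pow, Polynomial.eval_C, glueDerivTwo]
    push_cast
    ring
  · simp [glueDeriv]

theorem continuous_glueDeriv : Continuous glueDeriv :=
  continuous_iff_continuousAt.2 fun x => (hasDerivAt_glueDeriv x).continuousAt

theorem continuous_glueDerivTwo : Continuous glueDerivTwo := by
  have := expNegInvGlue.continuous_polynomial_eval_inv_mul
    (Polynomial.X ^ 4 - 2 * Polynomial.X ^ 3 : Polynomial ℝ)
  refine this.congr fun x => ?_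
  simp [glueDerivTwo]

theorem glueDeriv_nonneg (x : ℝ) : 0 ≤ glueDeriv x :=
  mul_nonneg (by positivity) (expNegInvGlue.nonneg x)

theorem glueDeriv_of_nonpos {x : ℝ} (hx : x ≤ 0) : glueDeriv x = 0 := by
  simp [glueDeriv, expNegInvGlue.zero_of_nonpos hx]

theorem glueDerivTwo_of_nonpos {x : ℝ} (hx : x ≤ 0) : glueDerivTwo x = 0 := by
  simp [glueDerivTwo, expNegInvGlue.zero_of_nonpos hx]

/-- Convexity of the profile up to `1 / 2`. This is why the logarithmic cutoffs below take the value
`1 / 2` as their argument on the unit sphere. -/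
theorem glueDerivTwo_nonneg {x : ℝ} (hx : x ≤ 1 / 2) : 0 ≤ glueDerivTwo x := by
  rcases le_or_gt x 0 with h | h
  · rw [glueDerivTwo_of_nonpos h]
  · refine mul_nonneg ?_ (expNegInvGlue.nonneg x)
    have h2 : 2 ≤ x⁻¹ := by
      rw [le_inv_comm₀ (by norm_num) h]; linarith
    have : x⁻¹ ^ 4 - 2 * x⁻¹ ^ 3 = x⁻¹ ^ 3 * (x⁻¹ - 2) := by ring
    rw [this]
    exact mul_nonneg (by positivity) (by linarith)

/-- A continuous function vanishing on `(-∞, 0]` is bounded on `(-∞, 1]`. -/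
theorem exists_bound_of_zero_of_nonpos {f : ℝ → ℝ} (hf : Continuous f) (h0 : ∀ x ≤ 0, f x = 0) :
    ∃ M : ℝ, 0 < M ∧ ∀ x ≤ 1, |f x| ≤ M := by
  obtain ⟨M, hM⟩ := (isCompact_Icc (a := (0 : ℝ)) (b := 1)).exists_bound_of_continuousOn
    hf.continuousOn
  refine ⟨max M 1, by positivity, fun x hx => ?_⟩
  rcases le_or_gt x 0 with h | h
  · rw [h0 x h]; simp
  · exact (hM x ⟨h.le, hx⟩).trans (le_max_left _ _)

/-! ### Weakly superharmonic functions: monotone radial means and the strong minimum principle. -/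

/-- `w` is weakly superharmonic on `U`: `-Δ w ≥ 0` in the sense of distributions. -/
def WeaklySuperharmonicOn {n : ℕ} (w : EuclideanSpace ℝ (Fin n) → ℝ)
    (U : Set (EuclideanSpace ℝ (Fin n))) : Prop :=
  ∀ φ : EuclideanSpace ℝ (Fin n) → ℝ, ContDiff ℝ ∞ φ → HasCompactSupport φ → tsupport φ ⊆ U →
    (∀ x, 0 ≤ φ x) → ∫ x in U, w x * (Δ φ) x ≤ 0

/-- The radial mollification of `w` at `x` at scale `t`, for functions on the ball of radius
`R`. -/
noncomputable def radialMean {n : ℕ} (w : EuclideanSpace ℝ (Fin n) → ℝ)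
    (x : EuclideanSpace ℝ (Fin n)) (R t : ℝ) : ℝ :=
  ∫ y in Metric.closedBall x R, w y * ((t ^ n)⁻¹ * glueDeriv (1 - ‖y - x‖ ^ 2 / t ^ 2))

theorem laplacian_bump {n : ℕ} (x y : EuclideanSpace ℝ (Fin n)) {t : ℝ} (ht : 0 < t) :
    (Δ (fun y => expNegInvGlue (1 - ‖y - x‖ ^ 2 / t ^ 2))) y =
      -2 * (t ^ 2)⁻¹ * (n * glueDeriv (1 - ‖y - x‖ ^ 2 / t ^ 2)
        - 2 * (‖y - x‖ ^ 2 / t ^ 2) * glueDerivTwo (1 - ‖y - x‖ ^ 2 / t ^ 2)) := by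
  have hi : ∀ s : ℝ, HasDerivAt (fun s : ℝ => 1 - s / t ^ 2) (-(t ^ 2)⁻¹) s := by
    intro s
    simpa using! ((hasDerivAt_id s).div_const (t ^ 2)).const_sub 1
  have h1 : ∀ s : ℝ, HasDerivAt (fun s => expNegInvGlue (1 - s / t ^ 2))
      (glueDeriv (1 - s / t ^ 2) * (-(t ^ 2)⁻¹)) s := fun s =>
    (hasDerivAt_expNegInvGlue _).comp s (hi s)
  have h2 : HasDerivAt (fun s => glueDeriv (1 - s / t ^ 2) * (-(t ^ 2)⁻¹))
      (glueDerivTwo (1 - ‖y - x‖ ^ 2 / t ^ 2) * (-(t ^ 2)⁻¹) * (-(t ^ 2)⁻¹)) (‖y - x‖ ^ 2) :=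
    ((hasDerivAt_glueDeriv _).comp _ (hi _)).mul_const _
  rw [laplacian_radial (P := fun s => expNegInvGlue (1 - s / t ^ 2))
    (Eventually.of_forall h1) h2]
  field_simp
  ring

theorem hasDerivAt_mollifier (n : ℕ) (r : ℝ) {t : ℝ} (ht : 0 < t) :
    HasDerivAt (fun t : ℝ => (t ^ n)⁻¹ * glueDeriv (1 - r / t ^ 2))
      (-(t ^ (n + 1))⁻¹ * (n * glueDeriv (1 - r / t ^ 2)
        - 2 * (r / t ^ 2) * glueDerivTwo (1 - r / t ^ 2))) t := by
  have h1 : HasDerivAt (fun t : ℝ => 1 - r / t ^ 2) (2 * r / t ^ 3) t := by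
    have := (((hasDerivAt_pow 2 t).inv (by positivity)).const_mul r).const_sub 1
    refine (this.congr_deriv ?_).congr_of_eventuallyEq (Eventually.of_forall fun s => ?_)
    · simp; field_simp
    · simp [div_eq_mul_inv]
  have h2 := ((hasDerivAt_pow n t).inv (by positivity)).mul
    ((hasDerivAt_glueDeriv (1 - r / t ^ 2)).comp t h1)
  refine h2.congr_deriv ?_
  rcases n with _ | n
  · simp; field_simp
  · simp; field_simp; ring

/-- Supplies the dominating function for differentiating `radialMean` under the integral sign. -/
theorem exists_bound_mollifier (n : ℕ) : ∃ Q : ℝ, 0 < Q ∧ ∀ s : ℝ, 0 ≤ s →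
    |n * glueDeriv (1 - s) - 2 * s * glueDerivTwo (1 - s)| ≤ Q := by
  obtain ⟨Q, hQ, h⟩ := exists_bound_of_zero_of_nonpos
    (f := fun x => n * glueDeriv x - 2 * (1 - x) * glueDerivTwo x)
    ((continuous_const.mul continuous_glueDeriv).sub
      ((continuous_const.mul (continuous_const.sub continuous_id)).mul continuous_glueDerivTwo))
    (fun x hx => by simp [glueDeriv_of_nonpos hx, glueDerivTwo_of_nonpos hx])
  exact ⟨Q, hQ, fun s hs => by simpa using h (1 - s) (by linarith)⟩

theorem tsupport_bump_subset {n : ℕ} (x : EuclideanSpace ℝ (Fin n)) {t : ℝ} (ht : 0 < t) :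
    tsupport (fun y => expNegInvGlue (1 - ‖y - x‖ ^ 2 / t ^ 2)) ⊆ Metric.closedBall x t := by
  refine closure_minimal (fun y hy => ?_) Metric.isClosed_closedBall
  by_contra hc
  refine hy (expNegInvGlue.zero_of_nonpos ?_)
  rw [Metric.mem_closedBall, dist_eq_norm, not_le] at hc
  rw [sub_nonpos, one_le_div (by positivity)]
  exact pow_le_pow_left₀ ht.le hc.le 2

/-- The kernel is chosen so that its derivative in `t` is a positive multiple, `t^(1-n) / 2`, of the
Laplacian of the nonnegative test function `expNegInvGlue (1 - |y - x|² / t²)` (compare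
`laplacian_bump` and `hasDerivAt_mollifier`). Superharmonicity then gives the sign of the derivative
directly, without spherical means. -/
theorem WeaklySuperharmonicOn.antitoneOn_radialMean {n : ℕ} {w : EuclideanSpace ℝ (Fin n) → ℝ}
    {U : Set (EuclideanSpace ℝ (Fin n))} (hU : MeasurableSet U)
    (hw : WeaklySuperharmonicOn w U) {x : EuclideanSpace ℝ (Fin n)} {R : ℝ}
    (hR : Metric.closedBall x R ⊆ U) (hint : IntegrableOn w (Metric.closedBall x R)) :
    AntitoneOn (radialMean w x R) (Set.Ioo 0 R) := by
  obtain ⟨Q, hQ, hQb⟩ := exists_bound_mollifier n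
  have hc : ∀ t : ℝ, Continuous fun y : EuclideanSpace ℝ (Fin n) => 1 - ‖y - x‖ ^ 2 / t ^ 2 :=
    fun t => by fun_prop
  have key : ∀ t ∈ Set.Ioo 0 R, ∃ d ≤ 0, HasDerivAt (radialMean w x R) d t := by
    intro t ht
    have ht0 : 0 < t := ht.1
    refine ⟨_, ?_, (hasDerivAt_integral_of_dominated_loc_of_deriv_le
      (F' := fun t y => w y * (-(t ^ (n + 1))⁻¹ * (n * glueDeriv (1 - ‖y - x‖ ^ 2 / t ^ 2)
        - 2 * (‖y - x‖ ^ 2 / t ^ 2) * glueDerivTwo (1 - ‖y - x‖ ^ 2 / t ^ 2))))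
      -- Restricting to scales `s > t / 2` keeps the factor `s^(-(n+1))` bounded.
      (bound := fun y => ‖w y‖ * (((t / 2) ^ (n + 1))⁻¹ * Q))
      (Ioi_mem_nhds (show t / 2 < t by linarith)) ?_ ?_ ?_ ?_ ?_ ?_).2⟩
    · have e : ∫ y in Metric.closedBall x R, w y * (-(t ^ (n + 1))⁻¹ *
          (n * glueDeriv (1 - ‖y - x‖ ^ 2 / t ^ 2)
            - 2 * (‖y - x‖ ^ 2 / t ^ 2) * glueDerivTwo (1 - ‖y - x‖ ^ 2 / t ^ 2)))
          = (t ^ (n + 1))⁻¹ * (t ^ 2 / 2) * ∫ y in U, w y *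
            (Δ (fun y => expNegInvGlue (1 - ‖y - x‖ ^ 2 / t ^ 2))) y := by
        rw [setIntegral_eq_of_subset_of_forall_sdiff_eq_zero hU hR, ← integral_const_mul]
        · refine integral_congr_ae (Eventually.of_forall fun y => ?_)
          simp only [laplacian_bump x y ht0]
          field_simp
        · intro y hy
          rw [laplacian_eq_zero_of_notMem_tsupport, mul_zero]
          exact fun h => hy.2 (Metric.closedBall_subset_closedBall ht.2.le
            (tsupport_bump_subset x ht0 h))
      rw [e]
      refine mul_nonpos_of_nonneg_of_nonpos (by positivity) (hw _ ?_ ?_ ?_ ?_)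
      · exact contDiff_radial (P := fun s => expNegInvGlue (1 - s / t ^ 2))
          (expNegInvGlue.contDiff.comp (contDiff_const.sub (contDiff_id.div_const _))) x
      · exact (isCompact_closedBall x t).of_isClosed_subset (isClosed_tsupport _)
          (tsupport_bump_subset x ht0)
      · exact (tsupport_bump_subset x ht0).trans
          ((Metric.closedBall_subset_closedBall ht.2.le).trans hR)
      · exact fun y => expNegInvGlue.nonneg _
    · refine Eventually.of_forall fun s => hint.aestronglyMeasurable.mul ?_
      exact (continuous_const.mul
        (continuous_glueDeriv.comp (hc s))).aestronglyMeasurable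
    · refine hint.mul_continuousOn ?_ (isCompact_closedBall x R)
      exact (continuous_const.mul (continuous_glueDeriv.comp (hc t))).continuousOn
    · refine hint.aestronglyMeasurable.mul (Continuous.aestronglyMeasurable ?_)
      exact continuous_const.mul ((continuous_const.mul (continuous_glueDeriv.comp (hc t))).sub
        (Continuous.mul (by fun_prop) (continuous_glueDerivTwo.comp (hc t))))
    · refine Eventually.of_forall fun y s hs => ?_
      have hs' : t / 2 < s := hs
      rw [norm_mul]
      gcongr
      rw [norm_mul, norm_neg, Real.norm_of_nonneg (inv_nonneg.2 (pow_nonneg (by linarith) _))]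
      gcongr
      exact hQb _ (by positivity)
    · exact hint.norm.mul_const _
    · refine Eventually.of_forall fun y s hs => ?_
      have hs' : t / 2 < s := hs
      exact (hasDerivAt_mollifier n _ (by linarith)).const_mul _
  refine antitoneOn_of_deriv_nonpos (convex_Ioo 0 R) ?_ ?_ ?_
  · intro t ht
    obtain ⟨d, -, hd⟩ := key t ht
    exact hd.continuousAt.continuousWithinAt
  · intro t ht
    obtain ⟨d, -, hd⟩ := key t (interior_subset ht)
    exact hd.differentiableAt.differentiableWithinAt
  · intro t ht
    obtain ⟨d, hd0, hd⟩ := key t (interior_subset ht)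
    rw [hd.deriv]
    exact hd0

/-- Points of the `δ`-ball about `x₀` are within `2δ` of `x`, so at scale `3δ` the argument of the
kernel is at least `1 - 4/9 = 5/9`. The lower bound is therefore uniform in `x`. -/
theorem le_radialMean {n : ℕ} {w : EuclideanSpace ℝ (Fin n) → ℝ} {x x₀ : EuclideanSpace ℝ (Fin n)}
    {R δ : ℝ} (hδ : 0 < δ) (hR : 3 * δ ≤ R) (hx : dist x x₀ ≤ δ)
    (hint : IntegrableOn w (Metric.closedBall x R))
    (hnn : ∀ᵐ y ∂(volume.restrict (Metric.closedBall x R)), 0 ≤ w y) :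
    (((3 * δ) ^ n)⁻¹ * expNegInvGlue (5 / 9)) * ∫ y in Metric.ball x₀ δ, w y
      ≤ radialMean w x R (3 * δ) := by
  have hsub : Metric.ball x₀ δ ⊆ Metric.closedBall x R := fun y hy => by
    rw [Metric.mem_closedBall]
    linarith [dist_triangle_right y x x₀, Metric.mem_ball.1 hy]
  have hint' : IntegrableOn (fun y => w y * (((3 * δ) ^ n)⁻¹ *
      glueDeriv (1 - ‖y - x‖ ^ 2 / (3 * δ) ^ 2))) (Metric.closedBall x R) := by
    refine hint.mul_continuousOn ?_ (isCompact_closedBall x R)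
    exact (continuous_const.mul (continuous_glueDeriv.comp (by fun_prop))).continuousOn
  rw [← integral_const_mul]
  refine le_trans ?_ (setIntegral_mono_set hint' ?_ (Eventually.of_forall hsub))
  · refine setIntegral_mono_on_ae ((hint.mono_set hsub).const_mul _) (hint'.mono_set hsub)
      Metric.isOpen_ball.measurableSet ?_
    filter_upwards [(ae_restrict_iff' measurableSet_closedBall).1 hnn] with y hy hyB
    rw [mul_comm]
    refine mul_le_mul_of_nonneg_left ?_ (hy (hsub hyB))
    refine mul_le_mul_of_nonneg_left ?_ (by positivity)
    have hd : ‖y - x‖ ≤ 2 * δ := by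
      rw [← dist_eq_norm]
      linarith [dist_triangle_right y x x₀, Metric.mem_ball.1 hyB]
    have h1 : ‖y - x‖ ^ 2 / (3 * δ) ^ 2 ≤ 4 / 9 := by
      rw [div_le_iff₀ (by positivity)]
      calc ‖y - x‖ ^ 2 ≤ (2 * δ) ^ 2 := pow_le_pow_left₀ (norm_nonneg _) hd 2
        _ = _ := by ring
    have h0 : 0 ≤ ‖y - x‖ ^ 2 / (3 * δ) ^ 2 := by positivity
    set s := 1 - ‖y - x‖ ^ 2 / (3 * δ) ^ 2 with hs
    have hs1 : 5 / 9 ≤ s := by linarith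
    have hs2 : 1 ≤ s⁻¹ := (one_le_inv₀ (by linarith)).2 (by linarith)
    calc expNegInvGlue (5 / 9) ≤ expNegInvGlue s := expNegInvGlue.monotone hs1
      _ ≤ s⁻¹ ^ 2 * expNegInvGlue s :=
        le_mul_of_one_le_left (expNegInvGlue.nonneg _) (one_le_pow₀ hs2)
  · filter_upwards [hnn] with y hy
    exact mul_nonneg hy (mul_nonneg (by positivity) (glueDeriv_nonneg _))

/-- The kernel is at most `M t^(-n)` and lives on a ball of volume `V t^n`. This comparison lets
Lebesgue differentiation bound the means as `t → 0`. -/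
theorem radialMean_le {n : ℕ} {w : EuclideanSpace ℝ (Fin n) → ℝ} {x : EuclideanSpace ℝ (Fin n)}
    {R t M : ℝ} (ht : 0 < t) (htR : t ≤ R) (hM : ∀ s ≤ 1, |glueDeriv s| ≤ M)
    (hint : IntegrableOn w (Metric.closedBall x R))
    (hnn : ∀ᵐ y ∂(volume.restrict (Metric.closedBall x R)), 0 ≤ w y) :
    radialMean w x R t ≤ M * volume.real (Metric.closedBall (0 : EuclideanSpace ℝ (Fin n)) 1) *
      ⨍ y in Metric.closedBall x t, w y := by
  have hsub : Metric.closedBall x t ⊆ Metric.closedBall x R :=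
    Metric.closedBall_subset_closedBall htR
  have hV : 0 < volume.real (Metric.closedBall (0 : EuclideanSpace ℝ (Fin n)) 1) :=
    ENNReal.toReal_pos (Metric.measure_closedBall_pos _ _ one_pos).ne'
      (isCompact_closedBall _ _).measure_lt_top.ne
  have e : radialMean w x R t = ∫ y in Metric.closedBall x t,
      w y * ((t ^ n)⁻¹ * glueDeriv (1 - ‖y - x‖ ^ 2 / t ^ 2)) := by
    refine setIntegral_eq_of_subset_of_forall_sdiff_eq_zero measurableSet_closedBall hsub ?_
    intro y hy
    rw [glueDeriv_of_nonpos, mul_zero, mul_zero]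
    have hc := hy.2
    rw [Metric.mem_closedBall, dist_eq_norm, not_le] at hc
    rw [sub_nonpos, one_le_div (by positivity)]
    exact pow_le_pow_left₀ ht.le hc.le 2
  have hint' : IntegrableOn (fun y => w y * ((t ^ n)⁻¹ *
      glueDeriv (1 - ‖y - x‖ ^ 2 / t ^ 2))) (Metric.closedBall x t) := by
    refine (hint.mono_set hsub).mul_continuousOn ?_ (isCompact_closedBall x t)
    exact (continuous_const.mul (continuous_glueDeriv.comp (by fun_prop))).continuousOn
  rw [e, setAverage_eq, Measure.addHaar_real_closedBall' _ _ ht.le, finrank_euclideanSpace_fin]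
  have e2 : M * volume.real (Metric.closedBall (0 : EuclideanSpace ℝ (Fin n)) 1) *
      (t ^ n * volume.real (Metric.closedBall (0 : EuclideanSpace ℝ (Fin n)) 1))⁻¹ •
        ∫ y in Metric.closedBall x t, w y
      = ∫ y in Metric.closedBall x t, w y * ((t ^ n)⁻¹ * M) := by
    rw [integral_mul_const, smul_eq_mul]
    field_simp
  rw [e2]
  refine setIntegral_mono_on_ae hint' ((hint.mono_set hsub).mul_const _)
    measurableSet_closedBall ?_
  filter_upwards [(ae_restrict_iff' measurableSet_closedBall).1 hnn] with y hy hyB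
  refine mul_le_mul_of_nonneg_left ?_ (hy (hsub hyB))
  refine mul_le_mul_of_nonneg_left ?_ (by positivity)
  have h0 : 0 ≤ ‖y - x‖ ^ 2 / t ^ 2 := by positivity
  exact (le_abs_self _).trans (hM _ (by linarith))

/-- If `w` has positive integral over the small ball, then `radialMean` at scale `3δ` is bounded
below uniformly in the centre. The means only grow as the scale shrinks, and at a Lebesgue point
their limit is controlled by a constant times `w x`. -/
theorem WeaklySuperharmonicOn.local_dichotomy {n : ℕ} {w : EuclideanSpace ℝ (Fin n) → ℝ}
    {U : Set (EuclideanSpace ℝ (Fin n))} (hU : IsOpen U) (hloc : LocallyIntegrableOn w U)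
    (hw : WeaklySuperharmonicOn w U) (hnn : ∀ᵐ x ∂(volume.restrict U), 0 ≤ w x)
    {x₀ : EuclideanSpace ℝ (Fin n)} (hx₀ : x₀ ∈ U) :
    ∃ δ > 0, Metric.ball x₀ δ ⊆ U ∧
      ((∀ᵐ x ∂(volume.restrict (Metric.ball x₀ δ)), w x = 0) ∨
        ∃ c > 0, ∀ᵐ x ∂(volume.restrict (Metric.ball x₀ δ)), c ≤ w x) := by
  obtain ⟨r, hr, hrU⟩ := Metric.isOpen_iff.1 hU x₀ hx₀
  -- Any `δ` with `5δ < r` works: balls of radius `4δ` about points of the `δ`-ball must stay inside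
  -- `U`.
  set δ := r / 8 with hδ
  have hδ0 : 0 < δ := by positivity
  have hK : Metric.closedBall x₀ (5 * δ) ⊆ U :=
    (Metric.closedBall_subset_ball (by linarith)).trans hrU
  have hKint : IntegrableOn w (Metric.closedBall x₀ (5 * δ)) :=
    hloc.integrableOn_compact_subset hK (isCompact_closedBall _ _)
  have hBK : Metric.ball x₀ δ ⊆ Metric.closedBall x₀ (5 * δ) :=
    Metric.ball_subset_closedBall.trans (Metric.closedBall_subset_closedBall (by linarith))
  refine ⟨δ, hδ0, hBK.trans hK, ?_⟩
  have hnnB : ∀ᵐ x ∂(volume.restrict (Metric.ball x₀ δ)), 0 ≤ w x :=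
    ae_restrict_of_ae_restrict_of_subset (hBK.trans hK) hnn
  rcases (integral_nonneg_of_ae hnnB).eq_or_lt with h0 | hI
  · left
    exact (integral_eq_zero_iff_of_nonneg_ae hnnB (hKint.mono_set hBK)).1 h0.symm
  right
  obtain ⟨M, hM0, hM⟩ := exists_bound_of_zero_of_nonpos continuous_glueDeriv
    fun x hx => glueDeriv_of_nonpos hx
  set V := volume.real (Metric.closedBall (0 : EuclideanSpace ℝ (Fin n)) 1) with hVdef
  have hV : 0 < V :=
    ENNReal.toReal_pos (Metric.measure_closedBall_pos _ _ one_pos).ne'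
      (isCompact_closedBall _ _).measure_lt_top.ne
  set a := (((3 * δ) ^ n)⁻¹ * expNegInvGlue (5 / 9)) * ∫ y in Metric.ball x₀ δ, w y with ha
  have ha0 : 0 < a :=
    mul_pos (mul_pos (by positivity) (expNegInvGlue.pos_of_pos (by norm_num))) hI
  refine ⟨a / (M * V), by positivity, ?_⟩
  have hloc' : LocallyIntegrable ((Metric.closedBall x₀ (5 * δ)).indicator w) volume :=
    (hKint.integrable_indicator measurableSet_closedBall).locallyIntegrable
  rw [ae_restrict_iff' Metric.isOpen_ball.measurableSet]
  filter_upwards [(Besicovitch.vitaliFamily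
    (volume : Measure (EuclideanSpace ℝ (Fin n)))).ae_tendsto_average hloc'] with x hx hxB
  have hxd : dist x x₀ < δ := hxB
  have hlim := hx.comp (Besicovitch.tendsto_filterAt volume x)
  rw [Set.indicator_of_mem (hBK hxB)] at hlim
  have hsub : Metric.closedBall x (4 * δ) ⊆ Metric.closedBall x₀ (5 * δ) :=
    Metric.closedBall_subset_closedBall' (by linarith)
  have hint := hKint.mono_set hsub
  have hnn' := ae_restrict_of_ae_restrict_of_subset (hsub.trans hK) hnn
  have h1 := le_radialMean hδ0 (by linarith : 3 * δ ≤ 4 * δ) hxd.le hint hnn'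
  have hanti := hw.antitoneOn_radialMean hU.measurableSet (hsub.trans hK) hint
  rw [div_le_iff₀ (by positivity), mul_comm]
  refine ge_of_tendsto (hlim.const_mul (M * V)) ?_
  filter_upwards [Ioc_mem_nhdsGT (by positivity : 0 < 3 * δ)] with t ht
  calc a ≤ radialMean w x (4 * δ) (3 * δ) := h1
    _ ≤ radialMean w x (4 * δ) t :=
      hanti ⟨ht.1, by linarith [ht.2]⟩ ⟨by linarith, by linarith⟩ ht.2
    _ ≤ M * V * ⨍ y in Metric.closedBall x t, w y :=
      radialMean_le ht.1 (by linarith [ht.2]) hM hint hnn'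
    _ = _ := by
      simp only [Function.comp]
      congr 1
      refine setAverage_congr_fun measurableSet_closedBall (Eventually.of_forall fun y hy => ?_)
      rw [Set.indicator_of_mem]
      exact hsub (Metric.closedBall_subset_closedBall (by linarith [ht.2]) hy)

/-- The strong minimum principle for nonnegative weakly superharmonic functions. -/
theorem WeaklySuperharmonicOn.strong_minimum_principle {n : ℕ}
    {w : EuclideanSpace ℝ (Fin n) → ℝ} {U : Set (EuclideanSpace ℝ (Fin n))} (hU : IsOpen U)
    (hconn : IsPreconnected U) (hloc : LocallyIntegrableOn w U)
    (hw : WeaklySuperharmonicOn w U) (hnn : ∀ᵐ x ∂(volume.restrict U), 0 ≤ w x) :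
    (∀ᵐ x ∂(volume.restrict U), w x = 0) ∨
      ∀ x₀ ∈ U, ∃ δ > 0, ∃ c > 0, ∀ᵐ x ∂(volume.restrict (Metric.ball x₀ δ)), c ≤ w x := by
  set A : Set (EuclideanSpace ℝ (Fin n)) :=
    {x₀ | ∃ δ > 0, ∀ᵐ x ∂(volume.restrict (Metric.ball x₀ δ)), w x = 0} with hA
  set B : Set (EuclideanSpace ℝ (Fin n)) :=
    {x₀ | ∃ δ > 0, ∃ c > 0, ∀ᵐ x ∂(volume.restrict (Metric.ball x₀ δ)), c ≤ w x} with hB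
  have hsubball : ∀ {x y : EuclideanSpace ℝ (Fin n)} {δ : ℝ}, y ∈ Metric.ball x δ →
      0 < δ - dist y x ∧ Metric.ball y (δ - dist y x) ⊆ Metric.ball x δ := fun {x y δ} hy =>
    ⟨sub_pos.2 hy, Metric.ball_subset_ball' (by linarith)⟩
  have hAo : IsOpen A := by
    refine Metric.isOpen_iff.2 fun x ⟨δ, hδ, h⟩ => ⟨δ, hδ, fun y hy => ?_⟩
    exact ⟨_, (hsubball hy).1, ae_restrict_of_ae_restrict_of_subset (hsubball hy).2 h⟩
  have hBo : IsOpen B := by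
    refine Metric.isOpen_iff.2 fun x ⟨δ, hδ, c, hc, h⟩ => ⟨δ, hδ, fun y hy => ?_⟩
    exact ⟨_, (hsubball hy).1, c, hc, ae_restrict_of_ae_restrict_of_subset (hsubball hy).2 h⟩
  -- By the local dichotomy, `A` and `B` cover `U`; they are open and cannot meet, since balls have
  -- positive measure. Connectedness selects one of them.
  have hcover : U ⊆ A ∪ B := fun x hx => by
    obtain ⟨δ, hδ, -, h | ⟨c, hc, h⟩⟩ := hw.local_dichotomy hU hloc hnn hx
    · exact Or.inl ⟨δ, hδ, h⟩
    · exact Or.inr ⟨δ, hδ, c, hc, h⟩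
  have hdisj : U ∩ (A ∩ B) = ∅ := by
    rw [Set.eq_empty_iff_forall_notMem]
    rintro x ⟨-, ⟨δ, hδ, h⟩, ⟨δ', hδ', c, hc, h'⟩⟩
    have hpos : 0 < min δ δ' := lt_min hδ hδ'
    have h1 := ae_restrict_of_ae_restrict_of_subset
      (Metric.ball_subset_ball (min_le_left δ δ') : Metric.ball x _ ⊆ _) h
    have h2 := ae_restrict_of_ae_restrict_of_subset
      (Metric.ball_subset_ball (min_le_right δ δ') : Metric.ball x _ ⊆ _) h'
    have h3 : ∀ᵐ y ∂(volume.restrict (Metric.ball x (min δ δ'))), False := by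
      filter_upwards [h1, h2] with y hy hy'
      linarith
    rw [ae_iff] at h3
    simp only [not_false_eq_true, Set.ofPred_true, Measure.restrict_apply_univ] at h3
    exact (Metric.measure_ball_pos volume x hpos).ne' h3
  rcases isPreconnected_iff_subset_of_disjoint.1 hconn A B hAo hBo hcover hdisj with h | h
  · left
    rw [ae_iff, Measure.restrict_apply₀']
    · refine measure_null_of_locally_null _ fun x hx => ?_
      obtain ⟨δ, hδ, hz⟩ := h hx.2
      rw [ae_iff, Measure.restrict_apply' Metric.isOpen_ball.measurableSet] at hz
      refine ⟨_, ?_, hz⟩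
      exact inter_mem (mem_of_superset self_mem_nhdsWithin Set.inter_subset_left)
        (mem_nhdsWithin_of_mem_nhds (Metric.ball_mem_nhds x hδ))
    · exact hU.measurableSet.nullMeasurableSet
  · right
    exact fun x hx => h hx

/-! ### Integrability of `W w` near the origin. -/

theorem isOpen_puncturedBall (n : ℕ) :
    IsOpen (Metric.ball (0 : EuclideanSpace ℝ (Fin n)) 1 \ {0}) :=
  Metric.isOpen_ball.sdiff isClosed_singleton

/-- Locally integrable times continuous with compact support in the domain is integrable. -/
theorem integrableOn_mul_of_tsupport_subset {n : ℕ} {w g : EuclideanSpace ℝ (Fin n) → ℝ}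
    {U K : Set (EuclideanSpace ℝ (Fin n))} (hU : IsOpen U) (hw : LocallyIntegrableOn w U)
    (hg : Continuous g) (hK : IsCompact K) (hKU : K ⊆ U) (hgK : ∀ x ∉ K, g x = 0) :
    IntegrableOn (fun x => w x * g x) U := by
  refine IntegrableOn.of_forall_sdiff_eq_zero (s := K) ?_ hU.measurableSet
    fun x hx => by rw [hgK x hx.2, mul_zero]
  exact (hw.integrableOn_compact_subset hKU hK).mul_continuousOn hg.continuousOn hK

theorem integrableOn_potential_mul {n : ℕ} {W w φ : EuclideanSpace ℝ (Fin n) → ℝ}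
    {U : Set (EuclideanSpace ℝ (Fin n))} (hU : IsOpen U) (hW : MemLinftyLoc W U)
    (hw : LocallyIntegrableOn w U) (hφ : Continuous φ) (hφc : HasCompactSupport φ)
    (hφU : tsupport φ ⊆ U) : IntegrableOn (fun x => W x * w x * φ x) U := by
  refine IntegrableOn.of_forall_sdiff_eq_zero (s := tsupport φ) ?_ hU.measurableSet
    fun x hx => by rw [image_eq_zero_of_notMem_tsupport hx.2, mul_zero]
  refine IntegrableOn.mul_continuousOn ?_ hφ.continuousOn hφc
  exact (hw.integrableOn_compact_subset hφU hφc).mul_of_top_right (hW _ hφU hφc)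

theorem IsWeakSolution.integral_mul_laplacian {n : ℕ} {W w φ : EuclideanSpace ℝ (Fin n) → ℝ}
    {U : Set (EuclideanSpace ℝ (Fin n))} (h : IsWeakSolution W w U) (hφ : ContDiff ℝ ∞ φ)
    (hφc : HasCompactSupport φ) (hφU : tsupport φ ⊆ U) :
    ∫ x in U, w x * (Δ φ) x = -∫ x in U, W x * w x * φ x := by
  rw [← h φ hφ hφc hφU, ← integral_neg]
  simp

theorem IsWeakSolution.weaklySuperharmonicOn {n : ℕ} {W w : EuclideanSpace ℝ (Fin n) → ℝ}
    {U : Set (EuclideanSpace ℝ (Fin n))} (h : IsWeakSolution W w U)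
    (hWw : ∀ᵐ x ∂(volume.restrict U), 0 ≤ W x * w x) : WeaklySuperharmonicOn w U := by
  intro φ hφ hφc hφU hφ0
  rw [h.integral_mul_laplacian hφ hφc hφU, neg_nonpos]
  refine integral_nonneg_of_ae ?_
  filter_upwards [hWw] with x hx
  exact mul_nonneg hx (hφ0 x)

/-- A smooth cutoff profile: `1` on `(-∞, 1/4]` and `0` on `[1/2, ∞)`. -/
noncomputable def cutoff (s : ℝ) : ℝ := Real.smoothTransition (2 - 4 * s)

theorem contDiff_cutoff : ContDiff ℝ ∞ cutoff :=
  Real.smoothTransition.contDiff.comp (contDiff_const.sub (contDiff_const.mul contDiff_id))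

theorem cutoff_of_le {s : ℝ} (hs : s ≤ 1 / 4) : cutoff s = 1 :=
  Real.smoothTransition.one_of_one_le (by linarith)

theorem cutoff_of_ge {s : ℝ} (hs : 1 / 2 ≤ s) : cutoff s = 0 :=
  Real.smoothTransition.zero_of_nonpos (by linarith)

/-- The radial Laplacian of the cutoff, as a function of the squared radius. -/
noncomputable def cutoffLaplacian (n : ℕ) (s : ℝ) : ℝ :=
  4 * s * deriv (deriv cutoff) s + 2 * n * deriv cutoff s

theorem contDiff_deriv_cutoff : ContDiff ℝ ∞ (deriv cutoff) :=
  (contDiff_infty_iff_deriv.1 contDiff_cutoff).2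

theorem continuous_cutoffLaplacian (n : ℕ) : Continuous (cutoffLaplacian n) := by
  have h1 := contDiff_deriv_cutoff.continuous
  have h2 := (contDiff_infty_iff_deriv.1 contDiff_deriv_cutoff).2.continuous
  unfold cutoffLaplacian
  fun_prop

theorem cutoffLaplacian_eq_zero (n : ℕ) {s : ℝ} (hs : s ∉ Set.Icc (1 / 4 : ℝ) (1 / 2)) :
    cutoffLaplacian n s = 0 := by
  have h : ∃ c : ℝ, cutoff =ᶠ[𝓝 s] fun _ => c := by
    rw [Set.mem_Icc, not_and_or, not_le, not_le] at hs
    rcases hs with hs | hs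
    · exact ⟨1, by filter_upwards [gt_mem_nhds hs] with y hy using cutoff_of_le hy.le⟩
    · exact ⟨0, by filter_upwards [lt_mem_nhds hs] with y hy using cutoff_of_ge hy.le⟩
  obtain ⟨c, hc⟩ := h
  simp [cutoffLaplacian, hc.deriv.deriv_eq, hc.deriv_eq]

theorem laplacian_cutoff {n : ℕ} (T : ℝ) (x : EuclideanSpace ℝ (Fin n)) :
    (Δ (fun y : EuclideanSpace ℝ (Fin n) => cutoff (T ^ 2 * ‖y - 0‖ ^ 2))) x =
      T ^ 2 * cutoffLaplacian n (T ^ 2 * ‖x‖ ^ 2) := by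
  have hi : ∀ s : ℝ, HasDerivAt (fun s : ℝ => T ^ 2 * s) (T ^ 2) s := fun s => by
    simpa using (hasDerivAt_id s).const_mul (T ^ 2)
  have h1 : ∀ s : ℝ, HasDerivAt (fun s => cutoff (T ^ 2 * s))
      (deriv cutoff (T ^ 2 * s) * T ^ 2) s := fun s =>
    ((contDiff_cutoff.differentiable (by simp)) _).hasDerivAt.comp s (hi s)
  have h2 := (((contDiff_deriv_cutoff.differentiable (by simp))
    (T ^ 2 * ‖x - 0‖ ^ 2)).hasDerivAt.comp _ (hi _)).mul_const (T ^ 2)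
  rw [laplacian_radial (P := fun s => cutoff (T ^ 2 * s)) (Eventually.of_forall h1) h2,
    cutoffLaplacian, sub_zero]
  ring

theorem contDiff_cutoff_radial {n : ℕ} (T : ℝ) :
    ContDiff ℝ ∞ fun y : EuclideanSpace ℝ (Fin n) => cutoff (T ^ 2 * ‖y - 0‖ ^ 2) :=
  contDiff_radial (P := fun s => cutoff (T ^ 2 * s))
    (contDiff_cutoff.comp (contDiff_const.mul contDiff_id)) 0

/-- The growth rate `|x|^(2-n)` is exactly the one for which this bound is independent of `T`: on
the shell `|x| ~ 1/T` the factors `T^(n-2)`, `T²` and the volume `T^(-n)` cancel. -/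
theorem abs_integral_mul_laplacian_cutoff_le {n : ℕ} {w : EuclideanSpace ℝ (Fin n) → ℝ}
    {C ρ Q : ℝ} (hC : 0 < C)
    (hg : ∀ᵐ x : EuclideanSpace ℝ (Fin n), x ∈ Metric.ball 0 ρ → |w x| ≤ C * (‖x‖ ^ 2 / ‖x‖ ^ n))
    (hQ : ∀ s, |cutoffLaplacian n s| ≤ Q) {T : ℝ} (hT : 2 ≤ T) (hTρ : 1 / T < ρ) :
    |∫ x in Metric.ball 0 1 \ {0}, w x * (Δ (fun y : EuclideanSpace ℝ (Fin n) => cutoff (T ^ 2 * ‖y - 0‖ ^ 2))) x| ≤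
      C * 2 ^ n * Q * volume.real (Metric.closedBall (0 : EuclideanSpace ℝ (Fin n)) 1) := by
  have hT0 : 0 < T := by linarith
  have hsq : ∀ x : EuclideanSpace ℝ (Fin n), T ^ 2 * ‖x‖ ^ 2 ∈ Set.Icc (1 / 4 : ℝ) (1 / 2) →
      1 / (2 * T) ≤ ‖x‖ ∧ ‖x‖ ≤ 1 / T := by
    intro x hx
    constructor
    · rw [div_le_iff₀ (by positivity)]
      by_contra hc
      have : (T * ‖x‖) ^ 2 < (1 / 2) ^ 2 := pow_lt_pow_left₀ (by linarith) (by positivity) two_ne_zero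
      have h1 := hx.1
      nlinarith
    · rw [le_div_iff₀ hT0]
      by_contra hc
      have : 1 ^ 2 < (T * ‖x‖) ^ 2 := pow_lt_pow_left₀ (by linarith) (by positivity) two_ne_zero
      have h1 := hx.2
      nlinarith
  have hQ0 : 0 ≤ Q := (abs_nonneg _).trans (hQ 0)
  set A : Set (EuclideanSpace ℝ (Fin n)) :=
    {x | T ^ 2 * ‖x‖ ^ 2 ∈ Set.Icc (1 / 4 : ℝ) (1 / 2)} with hA
  have hAsub : A ⊆ Metric.ball 0 1 \ {0} := by
    intro x hx
    obtain ⟨h1, h2⟩ := hsq x hx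
    have h3 : 1 / T < 1 := by rw [div_lt_one hT0]; linarith
    refine ⟨by rw [mem_ball_zero_iff]; linarith, fun h => ?_⟩
    have : 0 < 1 / (2 * T) := by positivity
    rw [Set.mem_singleton_iff.1 h, norm_zero] at h1
    linarith
  have hAB : A ⊆ Metric.closedBall 0 (1 / T) := fun x hx => by
    rw [mem_closedBall_zero_iff]; exact (hsq x hx).2
  have hvol : volume A ≤ volume (Metric.closedBall (0 : EuclideanSpace ℝ (Fin n)) (1 / T)) :=
    measure_mono hAB
  have hfin : volume (Metric.closedBall (0 : EuclideanSpace ℝ (Fin n)) (1 / T)) < ⊤ :=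
    (isCompact_closedBall _ _).measure_lt_top
  rw [setIntegral_eq_of_subset_of_forall_sdiff_eq_zero (isOpen_puncturedBall n).measurableSet hAsub
    (fun x hx => by rw [laplacian_cutoff, cutoffLaplacian_eq_zero n hx.2, mul_zero, mul_zero])]
  refine (norm_setIntegral_le_of_norm_le_const_ae' (E := ℝ) (C := C * 2 ^ n * T ^ n * Q)
    (hvol.trans_lt hfin) ?_).trans ?_
  · filter_upwards [hg] with x hx hxA
    obtain ⟨h1, h2⟩ := hsq x hxA
    have hx0 : 0 < ‖x‖ := lt_of_lt_of_le (by positivity) h1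
    rw [laplacian_cutoff, norm_mul, norm_mul, Real.norm_eq_abs, Real.norm_eq_abs, Real.norm_eq_abs,
      abs_of_nonneg (by positivity : 0 ≤ T ^ 2)]
    have h3 : 1 ≤ 2 ^ n * T ^ n * ‖x‖ ^ n := by
      rw [← mul_pow, ← mul_pow]
      refine one_le_pow₀ ?_
      rw [div_le_iff₀ (by positivity)] at h1
      linarith
    calc |w x| * (T ^ 2 * |cutoffLaplacian n (T ^ 2 * ‖x‖ ^ 2)|)
        ≤ (C * (‖x‖ ^ 2 / ‖x‖ ^ n)) * (T ^ 2 * Q) := by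
          gcongr
          · exact hx (by rw [mem_ball_zero_iff]; linarith)
          · exact hQ _
      _ = C * Q * (T ^ 2 * ‖x‖ ^ 2) * (1 / ‖x‖ ^ n) := by ring
      _ ≤ C * Q * 1 * (2 ^ n * T ^ n) := by
          gcongr
          · exact (hxA.2).trans (by norm_num)
          · rw [div_le_iff₀ (by positivity)]; exact h3
      _ = _ := by ring
  · have h4 : volume.real A ≤ (1 / T) ^ n *
        volume.real (Metric.closedBall (0 : EuclideanSpace ℝ (Fin n)) 1) := by
      have := Measure.addHaar_real_closedBall' (volume : Measure (EuclideanSpace ℝ (Fin n))) 0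
        (r := 1 / T) (by positivity)
      rw [finrank_euclideanSpace_fin] at this
      rw [← this]
      exact ENNReal.toReal_mono hfin.ne hvol
    calc C * 2 ^ n * T ^ n * Q * volume.real A ≤ C * 2 ^ n * T ^ n * Q * ((1 / T) ^ n *
        volume.real (Metric.closedBall (0 : EuclideanSpace ℝ (Fin n)) 1)) := by gcongr
      _ = _ := by rw [one_div, inv_pow]; field_simp

/-- For a nonnegative solution of size `O(|x|^(2-n))`, the right-hand side `W w` is integrable
near the origin. -/
theorem IsWeakSolution.lintegral_potential_mul_lt_top {n : ℕ}
    {W w : EuclideanSpace ℝ (Fin n) → ℝ}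
    (hW : MemLinftyLoc W (Metric.ball 0 1 \ {0}))
    (hw : LocallyIntegrableOn w (Metric.ball 0 1 \ {0}) volume)
    (hsol : IsWeakSolution W w (Metric.ball 0 1 \ {0}))
    (hWw : ∀ᵐ x ∂(volume.restrict (Metric.ball 0 1 \ {0})), 0 ≤ W x * w x)
    {C ρ : ℝ} (hC : 0 < C) (hρ : 0 < ρ)
    (hg : ∀ᵐ x : EuclideanSpace ℝ (Fin n), x ∈ Metric.ball 0 ρ →
      |w x| ≤ C * (‖x‖ ^ 2 / ‖x‖ ^ n)) :
    ∫⁻ x in Metric.ball 0 (1 / 2) \ {0}, ENNReal.ofReal (W x * w x) < ⊤ := by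
  set Ω := Metric.ball (0 : EuclideanSpace ℝ (Fin n)) 1 \ {0} with hΩ
  have hΩo : IsOpen Ω := isOpen_puncturedBall n
  obtain ⟨Q, hQ⟩ : ∃ Q, ∀ s, |cutoffLaplacian n s| ≤ Q := by
    obtain ⟨M, hM⟩ := (isCompact_Icc (a := (1 / 4 : ℝ)) (b := 1 / 2)).exists_bound_of_continuousOn
      (continuous_cutoffLaplacian n).continuousOn
    refine ⟨max M 0, fun s => ?_⟩
    by_cases hs : s ∈ Set.Icc (1 / 4 : ℝ) (1 / 2)
    · exact (hM s hs).trans (le_max_left _ _)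
    · rw [cutoffLaplacian_eq_zero n hs]; simp
  set ψ : ℝ → EuclideanSpace ℝ (Fin n) → ℝ := fun T y => cutoff (T ^ 2 * ‖y - 0‖ ^ 2) with hψ
  set M0 : ℝ := |∫ x in Ω, w x * (Δ (ψ 1)) x| with hM0
  set M1 : ℝ := C * 2 ^ n * Q * volume.real (Metric.closedBall (0 : EuclideanSpace ℝ (Fin n)) 1)
    with hM1
  have hLap : ∀ T : ℝ, 1 ≤ T → IntegrableOn (fun x => w x * (Δ (ψ T)) x) Ω := by
    intro T hT
    refine integrableOn_mul_of_tsupport_subset hΩo hw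
      (continuous_laplacian (contDiff_cutoff_radial T))
      (K := {x | T ^ 2 * ‖x‖ ^ 2 ∈ Set.Icc (1 / 4 : ℝ) (1 / 2)}) ?_ ?_ ?_
    · refine (isCompact_closedBall (0 : EuclideanSpace ℝ (Fin n)) 1).of_isClosed_subset
        (isClosed_Icc.preimage (by fun_prop)) fun x hx => ?_
      rw [mem_closedBall_zero_iff]
      by_contra hc
      have h1 := hx.2
      have h2 : 1 ≤ T ^ 2 * ‖x‖ ^ 2 :=
        one_le_mul_of_one_le_of_one_le (one_le_pow₀ hT) (one_le_pow₀ (not_le.1 hc).le)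
      linarith
    · intro x hx
      refine ⟨?_, ?_⟩
      · rw [mem_ball_zero_iff]
        by_contra hc
        have h1 := hx.2
        have h2 : 1 ≤ T ^ 2 * ‖x‖ ^ 2 :=
          one_le_mul_of_one_le_of_one_le (one_le_pow₀ hT) (one_le_pow₀ (not_lt.1 hc))
        linarith
      · rintro rfl
        have := hx.1
        norm_num at this
    · intro x hx
      rw [laplacian_cutoff, cutoffLaplacian_eq_zero n hx, mul_zero]
  have key : ∀ T : ℝ, 2 ≤ T → 1 / T < ρ →
      ∫⁻ x in (Metric.ball 0 (1 / 2) \ Metric.ball (0 : EuclideanSpace ℝ (Fin n)) (1 / T)),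
        ENNReal.ofReal (W x * w x) ≤ ENNReal.ofReal (M0 + M1) := by
    intro T hT hTρ
    have hT0 : 0 < T := by linarith
    -- The outer cutoff is fixed and the inner one shrinks. Since `T² ≥ 4`, `ψ T` vanishes wherever
    -- `ψ 1 < 1`, so the difference is nonnegative.
    set f : EuclideanSpace ℝ (Fin n) → ℝ := ψ 1 - ψ T with hf
    have hfs : ContDiff ℝ ∞ f := (contDiff_cutoff_radial 1).sub (contDiff_cutoff_radial T)
    have hT4 : (4 : ℝ) ≤ T ^ 2 := by nlinarith
    have hf0 : ∀ x, 0 ≤ f x := by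
      intro x
      simp only [hf, hψ, Pi.sub_apply, sub_zero, one_pow, one_mul, sub_nonneg]
      rcases le_total (‖x‖ ^ 2) (1 / 4) with h | h
      · rw [cutoff_of_le h]
        exact Real.smoothTransition.le_one _
      · rw [cutoff_of_ge (s := T ^ 2 * ‖x‖ ^ 2) (by nlinarith)]
        exact Real.smoothTransition.nonneg _
    have hsupp : tsupport f ⊆ {x | 1 / 4 ≤ T ^ 2 * ‖x‖ ^ 2 ∧ ‖x‖ ^ 2 ≤ 1 / 2} := by
      refine closure_minimal (fun x hx => ?_) ?_
      · by_contra hc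
        refine hx ?_
        rw [Set.mem_ofPred_eq, not_and_or, not_le, not_le] at hc
        simp only [hf, hψ, Pi.sub_apply, sub_zero, one_pow, one_mul]
        rcases hc with hc | hc
        · rw [cutoff_of_le hc.le, cutoff_of_le (by nlinarith [sq_nonneg ‖x‖]), sub_self]
        · rw [cutoff_of_ge hc.le, cutoff_of_ge (by nlinarith), sub_self]
      · exact (isClosed_le continuous_const
          (continuous_const.mul (continuous_norm.pow 2))).inter
          (isClosed_le (continuous_norm.pow 2) continuous_const)
    have hfc : HasCompactSupport f :=
      (isCompact_closedBall (0 : EuclideanSpace ℝ (Fin n)) 1).of_isClosed_subset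
        (isClosed_tsupport _) fun x hx => by
          rw [mem_closedBall_zero_iff]
          nlinarith [(hsupp hx).2, norm_nonneg x]
    have hfΩ : tsupport f ⊆ Ω := by
      intro x hx
      obtain ⟨h1, h2⟩ := hsupp hx
      refine ⟨?_, ?_⟩
      · rw [mem_ball_zero_iff]
        nlinarith [norm_nonneg x]
      · rintro rfl
        norm_num at h1
    have hint : ∫ x in Ω, W x * w x * f x ≤ M0 + M1 := by
      have h1 := hsol.integral_mul_laplacian hfs hfc hfΩ
      have h2 : ∫ x in Ω, w x * (Δ f) x =
          (∫ x in Ω, w x * (Δ (ψ 1)) x) - ∫ x in Ω, w x * (Δ (ψ T)) x := by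
        refine Eq.trans ?_ (integral_sub (hLap 1 le_rfl) (hLap T (by linarith)))
        refine integral_congr_ae (Eventually.of_forall fun x => ?_)
        simp only [hf]
        rw [ContDiffAt.laplacian_sub
          ((contDiff_cutoff_radial 1).contDiffAt.of_le (WithTop.coe_le_coe.2 le_top))
          ((contDiff_cutoff_radial T).contDiffAt.of_le (WithTop.coe_le_coe.2 le_top)), mul_sub]
      have h3 := abs_integral_mul_laplacian_cutoff_le hC hg hQ hT hTρ
      have h4 := neg_abs_le (∫ x in Ω, w x * (Δ (ψ 1)) x)
      have h5 : ∫ x in Ω, w x * (Δ (ψ T)) x ≤ M1 := (abs_le.1 h3).2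
      linarith
    set A := Metric.ball 0 (1 / 2) \ Metric.ball (0 : EuclideanSpace ℝ (Fin n)) (1 / T) with hA
    have hAΩ : A ⊆ Ω := by
      intro x hx
      refine ⟨Metric.ball_subset_ball (by norm_num) hx.1, ?_⟩
      rintro rfl
      exact hx.2 (Metric.mem_ball_self (by positivity))
    have hAm : MeasurableSet A := measurableSet_ball.diff measurableSet_ball
    have hone : ∀ x ∈ A, f x = 1 := by
      intro x hx
      have h1 : ‖x‖ < 1 / 2 := mem_ball_zero_iff.1 hx.1
      have h2 : 1 / T ≤ ‖x‖ := by
        have := hx.2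
        rwa [mem_ball_zero_iff, not_lt] at this
      have h3 : 1 ≤ T * ‖x‖ := by
        rw [div_le_iff₀ hT0] at h2
        linarith
      simp only [hf, hψ, Pi.sub_apply, sub_zero, one_pow, one_mul]
      rw [cutoff_of_le (by nlinarith [norm_nonneg x]), cutoff_of_ge (by nlinarith), sub_zero]
    have hiI := integrableOn_potential_mul hΩo hW hw hfs.continuous hfc hfΩ
    have hnn : 0 ≤ᵐ[volume.restrict Ω] fun x => W x * w x * f x := by
      filter_upwards [hWw] with x hx
      exact mul_nonneg hx (hf0 x)
    calc ∫⁻ x in A, ENNReal.ofReal (W x * w x)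
        = ∫⁻ x in A, ENNReal.ofReal (W x * w x * f x) :=
          setLIntegral_congr_fun hAm fun x hx => by simp only [hone x hx, mul_one]
      _ ≤ ∫⁻ x in Ω, ENNReal.ofReal (W x * w x * f x) := lintegral_mono_set hAΩ
      _ = ENNReal.ofReal (∫ x in Ω, W x * w x * f x) :=
          (ofReal_integral_eq_lintegral_ofReal hiI hnn).symm
      _ ≤ ENNReal.ofReal (M0 + M1) := ENNReal.ofReal_le_ofReal hint
  -- Starting from `N` makes every `T = N + k` admissible in `key`. The bound there does not depend
  -- on `T`, so it survives the monotone limit over the annuli.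
  obtain ⟨N, hN⟩ := exists_nat_gt (max 2 (1 / ρ))
  have hN2 : (2 : ℝ) < N := (le_max_left _ _).trans_lt hN
  have hNρ : 1 / ρ < N := (le_max_right _ _).trans_lt hN
  set s : ℕ → Set (EuclideanSpace ℝ (Fin n)) := fun k =>
    Metric.ball 0 (1 / 2) \ Metric.ball (0 : EuclideanSpace ℝ (Fin n)) (1 / ((N : ℝ) + k)) with hs
  have hmono : Monotone s := by
    intro i j hij
    refine Set.sdiff_subset_sdiff_right (Metric.ball_subset_ball ?_)
    gcongr
  have hcover : Metric.ball 0 (1 / 2) \ {0} ⊆ ⋃ k, s k := by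
    intro x hx
    have hx0 : 0 < ‖x‖ := norm_pos_iff.2 hx.2
    obtain ⟨k, hk⟩ := exists_nat_gt (1 / ‖x‖)
    refine Set.mem_iUnion.2 ⟨k, hx.1, ?_⟩
    rw [mem_ball_zero_iff, not_lt, div_le_iff₀ (by positivity)]
    rw [div_lt_iff₀ hx0] at hk
    nlinarith
  refine (lintegral_mono_set hcover).trans_lt ?_
  rw [setLIntegral_iUnion_of_directed _ hmono.directed_le]
  refine (iSup_le fun k : ℕ => key ((N : ℝ) + (k : ℕ)) ?_ ?_).trans_lt ENNReal.ofReal_lt_top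
  · have : (0 : ℝ) ≤ k := Nat.cast_nonneg k
    linarith
  · have : (0 : ℝ) ≤ k := Nat.cast_nonneg k
    rw [div_lt_iff₀ hρ] at hNρ
    rw [div_lt_iff₀ (by linarith)]
    nlinarith

/-! ### Removing the singularity in dimension at least two. -/

/-- Logarithmic cutoffs near the origin, which are subharmonic on the unit ball if `n ≥ 2`. -/
noncomputable def logCutoff {n : ℕ} (k : ℝ) (x : EuclideanSpace ℝ (Fin n)) : ℝ :=
  if x = 0 then 0 else expNegInvGlue (1 / 2 + Real.log (‖x‖ ^ 2) / (4 * k))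

theorem logCutoff_of_ne {n : ℕ} (k : ℝ) {x : EuclideanSpace ℝ (Fin n)} (hx : x ≠ 0) :
    logCutoff k x = expNegInvGlue (1 / 2 + Real.log (‖x‖ ^ 2) / (4 * k)) := if_neg hx

theorem logCutoff_nonneg {n : ℕ} (k : ℝ) (x : EuclideanSpace ℝ (Fin n)) : 0 ≤ logCutoff k x := by
  unfold logCutoff
  split_ifs
  exacts [le_rfl, expNegInvGlue.nonneg _]

theorem logCutoff_eventuallyEq {n : ℕ} {k : ℝ} {x : EuclideanSpace ℝ (Fin n)} (hx : x ≠ 0) :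
    logCutoff k =ᶠ[𝓝 x] fun y => expNegInvGlue (1 / 2 + Real.log (‖y - 0‖ ^ 2) / (4 * k)) := by
  filter_upwards [isOpen_ne.mem_nhds hx] with y hy
  rw [logCutoff_of_ne k hy, sub_zero]

theorem logCutoff_eventuallyEq_zero {n : ℕ} {k : ℝ} (hk : 0 < k) :
    (logCutoff k : EuclideanSpace ℝ (Fin n) → ℝ) =ᶠ[𝓝 0] fun _ => 0 := by
  filter_upwards [Metric.ball_mem_nhds (0 : EuclideanSpace ℝ (Fin n)) (Real.exp_pos (-k))]
    with y hy
  rcases eq_or_ne y 0 with rfl | h0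
  · simp [logCutoff]
  rw [logCutoff_of_ne k h0]
  refine expNegInvGlue.zero_of_nonpos ?_
  have hy0 : 0 < ‖y‖ := norm_pos_iff.2 h0
  have : Real.log ‖y‖ < -k := (Real.log_lt_iff_lt_exp hy0).2 (mem_ball_zero_iff.1 hy)
  rw [Real.log_pow]
  have h2 : (2 : ℕ) * Real.log ‖y‖ / (4 * k) ≤ -(1 / 2) := by
    rw [div_le_iff₀ (by positivity)]
    push_cast
    linarith
  linarith

theorem contDiff_logCutoff {n : ℕ} {k : ℝ} (hk : 0 < k) :
    ContDiff ℝ ∞ (logCutoff k : EuclideanSpace ℝ (Fin n) → ℝ) := by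
  refine contDiff_iff_contDiffAt.2 fun x => ?_
  rcases eq_or_ne x 0 with rfl | hx
  · exact contDiffAt_const.congr_of_eventuallyEq (logCutoff_eventuallyEq_zero hk)
  · refine ContDiffAt.congr_of_eventuallyEq ?_ (logCutoff_eventuallyEq hx)
    refine expNegInvGlue.contDiff.contDiffAt.comp x (contDiffAt_const.add (ContDiffAt.div_const
      (ContDiffAt.log ((contDiff_id.sub contDiff_const).norm_sq ℝ).contDiffAt ?_) _))
    simpa using hx

/-- The factor of `φ x` is the Laplacian of the cutoff. For `n ≥ 2` it is nonnegative on the unit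
ball: the profile is increasing, and convex at arguments up to `1 / 2`. -/
theorem laplacian_mul_logCutoff {n : ℕ} {φ : EuclideanSpace ℝ (Fin n) → ℝ} (hφ : ContDiff ℝ ∞ φ)
    {k : ℝ} (hk : 0 < k) {x : EuclideanSpace ℝ (Fin n)} (hx : x ≠ 0) :
    (Δ (fun y => φ y * logCutoff k y)) x = logCutoff k x * (Δ φ) x
      + glueDeriv (1 / 2 + Real.log (‖x‖ ^ 2) / (4 * k)) / (k * ‖x‖ ^ 2) * fderiv ℝ φ x x
      + φ x * (glueDerivTwo (1 / 2 + Real.log (‖x‖ ^ 2) / (4 * k)) / (4 * k ^ 2 * ‖x‖ ^ 2)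
        + (2 * n - 4) * (glueDeriv (1 / 2 + Real.log (‖x‖ ^ 2) / (4 * k))
          / (4 * k * ‖x‖ ^ 2))) := by
  have hx0 : 0 < ‖x‖ := norm_pos_iff.2 hx
  have hs0 : ‖x - 0‖ ^ 2 ≠ 0 := by rw [sub_zero]; positivity
  have hi : ∀ s : ℝ, s ≠ 0 → HasDerivAt (fun s : ℝ => 1 / 2 + Real.log s / (4 * k))
      (s⁻¹ / (4 * k)) s := fun s hs =>
    ((Real.hasDerivAt_log hs).div_const _).const_add _
  have h1 : ∀ s : ℝ, s ≠ 0 → HasDerivAt (fun s => expNegInvGlue (1 / 2 + Real.log s / (4 * k)))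
      (glueDeriv (1 / 2 + Real.log s / (4 * k)) * (s⁻¹ / (4 * k))) s := fun s hs =>
    (hasDerivAt_expNegInvGlue _).comp s (hi s hs)
  have h2 := ((hasDerivAt_glueDeriv (1 / 2 + Real.log (‖x - 0‖ ^ 2) / (4 * k))).comp
    (‖x - 0‖ ^ 2) (hi _ hs0)).mul ((hasDerivAt_inv hs0).div_const (4 * k))
  have e : (fun y => φ y * logCutoff k y) =ᶠ[𝓝 x]
      fun y => φ y * expNegInvGlue (1 / 2 + Real.log (‖y - 0‖ ^ 2) / (4 * k)) := by
    filter_upwards [logCutoff_eventuallyEq (k := k) hx] with y hy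
    rw [hy]
  rw [(InnerProductSpace.laplacian_congr_nhds e).eq_of_nhds,
    laplacian_mul_radial (P := fun s => expNegInvGlue (1 / 2 + Real.log s / (4 * k)))
      (hφ.contDiffAt.of_le (WithTop.coe_le_coe.2 le_top))
      (P1 := fun s => glueDeriv (1 / 2 + Real.log s / (4 * k)) * (s⁻¹ / (4 * k)))
      (Eventually.mono (isOpen_ne.mem_nhds hs0) h1) h2, logCutoff_of_ne k hx]
  simp only [sub_zero, Function.comp]
  field_simp
  ring

theorem integrableOn_norm_div_norm_pow {n : ℕ} (hn : 1 ≤ n) (ρ : ℝ) :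
    IntegrableOn (fun x : EuclideanSpace ℝ (Fin n) => ‖x‖ / ‖x‖ ^ n) (Metric.ball 0 ρ) := by
  have : Nonempty (Fin n) := ⟨⟨0, hn⟩⟩
  refine (integrableOn_fun_norm_addHaar (volume : Measure (EuclideanSpace ℝ (Fin n)))
    (f := fun r => r / r ^ n)).2 ?_
  rw [finrank_euclideanSpace_fin]
  -- In polar coordinates the density `r^(n-1)` turns the integrand into 1.
  refine (integrableOn_const (C := (1 : ℝ)) (by simp)).congr_fun (fun y hy => ?_) measurableSet_Ioo
  obtain ⟨m, rfl⟩ : ∃ m, n = m + 1 := ⟨n - 1, by omega⟩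
  have : 0 < y := hy.1
  simp only [Nat.add_sub_cancel, smul_eq_mul]
  field_simp
  ring

/-- A function of size `O(|x|^(2-n))` divided by `|x|` is integrable on compact subsets of the
unit ball. -/
theorem integrableOn_mul_inv_norm {n : ℕ} (hn : 1 ≤ n) {w : EuclideanSpace ℝ (Fin n) → ℝ}
    (hw : LocallyIntegrableOn w (Metric.ball 0 1 \ {0}) volume)
    {C ρ : ℝ} (hC : 0 < C) (hρ : 0 < ρ)
    (hg : ∀ᵐ x : EuclideanSpace ℝ (Fin n), x ∈ Metric.ball 0 ρ →
      |w x| ≤ C * (‖x‖ ^ 2 / ‖x‖ ^ n))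
    {K : Set (EuclideanSpace ℝ (Fin n))} (hK : IsCompact K) (hKb : K ⊆ Metric.ball 0 1) :
    IntegrableOn (fun x => w x * ‖x‖⁻¹) K := by
  have : Nonempty (Fin n) := ⟨⟨0, hn⟩⟩
  set r := min ρ 1 with hr
  have hr0 : 0 < r := lt_min hρ one_pos
  have hcover : K ⊆ (K \ Metric.ball 0 r) ∪ Metric.ball 0 r := fun x hx => by
    by_cases h : x ∈ Metric.ball 0 r
    exacts [Or.inr h, Or.inl ⟨hx, h⟩]
  refine IntegrableOn.mono_set (IntegrableOn.union ?_ ?_) hcover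
  · have hcK : IsCompact (K \ Metric.ball 0 r) := hK.diff Metric.isOpen_ball
    have hne : ∀ x ∈ K \ Metric.ball 0 r, x ≠ 0 := by
      rintro x hx rfl
      exact hx.2 (Metric.mem_ball_self hr0)
    refine (hw.integrableOn_compact_subset (fun x hx => ⟨hKb hx.1, hne x hx⟩) hcK).mul_continuousOn
      ?_ hcK
    exact continuousOn_id.norm.inv₀ fun x hx => norm_ne_zero_iff.2 (hne x hx)
  · have hmeas : AEStronglyMeasurable w (volume.restrict (Metric.ball 0 r)) := by
      have h1 : AEStronglyMeasurable w (volume.restrict (Metric.ball 0 1)) := by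
        have := hw.aestronglyMeasurable
        rwa [Measure.restrict_congr_set
          (sdiff_null_ae_eq_self (measure_singleton (μ := volume) 0))] at this
      exact h1.mono_measure (Measure.restrict_mono
        (Metric.ball_subset_ball (min_le_right _ _)) le_rfl)
    refine Integrable.mono' ((integrableOn_norm_div_norm_pow hn r).const_mul C) ?_ ?_
    · exact hmeas.mul (measurable_norm.inv.aestronglyMeasurable)
    · rw [ae_restrict_iff' measurableSet_ball]
      filter_upwards [hg, Measure.ae_ne volume (0 : EuclideanSpace ℝ (Fin n))] with x hx hx0 hxr
      have hxp : 0 < ‖x‖ := norm_pos_iff.2 hx0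
      rw [norm_mul, norm_inv, norm_norm, Real.norm_eq_abs]
      calc |w x| * ‖x‖⁻¹ ≤ C * (‖x‖ ^ 2 / ‖x‖ ^ n) * ‖x‖⁻¹ := by
            gcongr
            exact hx (Metric.ball_subset_ball (min_le_left _ _) hxr)
        _ = _ := by field_simp

theorem locallyIntegrableOn_ball {n : ℕ} (hn : 1 ≤ n) {w : EuclideanSpace ℝ (Fin n) → ℝ}
    (hw : LocallyIntegrableOn w (Metric.ball 0 1 \ {0}) volume)
    {C ρ : ℝ} (hC : 0 < C) (hρ : 0 < ρ)
    (hg : ∀ᵐ x : EuclideanSpace ℝ (Fin n), x ∈ Metric.ball 0 ρ →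
      |w x| ≤ C * (‖x‖ ^ 2 / ‖x‖ ^ n)) :
    LocallyIntegrableOn w (Metric.ball 0 1) volume := by
  have : Nonempty (Fin n) := ⟨⟨0, hn⟩⟩
  refine (locallyIntegrableOn_iff Metric.isOpen_ball.isLocallyClosed).2 fun K hKb hK => ?_
  refine IntegrableOn.congr_fun_ae ((integrableOn_mul_inv_norm hn hw hC hρ hg hK
    hKb).mul_continuousOn continuous_norm.continuousOn hK) ?_
  refine ae_restrict_of_ae ?_
  filter_upwards [Measure.ae_ne volume (0 : EuclideanSpace ℝ (Fin n))] with x hx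
  have : ‖x‖ ≠ 0 := norm_ne_zero_iff.2 hx
  field_simp

/-- In dimension at least two, a nonnegative function of size `O(|x|^(2-n))` that is weakly
superharmonic on the punctured unit ball is weakly superharmonic on the unit ball. -/
theorem WeaklySuperharmonicOn.removable_singularity {n : ℕ} (hn : 2 ≤ n)
    {w : EuclideanSpace ℝ (Fin n) → ℝ}
    (hw : LocallyIntegrableOn w (Metric.ball 0 1 \ {0}) volume)
    (hsup : WeaklySuperharmonicOn w (Metric.ball 0 1 \ {0}))
    (hnn : ∀ᵐ x ∂(volume.restrict (Metric.ball 0 1)), 0 ≤ w x)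
    {C ρ : ℝ} (hC : 0 < C) (hρ : 0 < ρ)
    (hg : ∀ᵐ x : EuclideanSpace ℝ (Fin n), x ∈ Metric.ball 0 ρ →
      |w x| ≤ C * (‖x‖ ^ 2 / ‖x‖ ^ n)) :
    WeaklySuperharmonicOn w (Metric.ball 0 1) := by
  have : Nonempty (Fin n) := ⟨⟨0, by omega⟩⟩
  intro φ hφ hφc hφb hφ0
  set B := Metric.ball (0 : EuclideanSpace ℝ (Fin n)) 1 with hB
  have hres : volume.restrict (B \ {0}) = volume.restrict B :=
    Measure.restrict_congr_set (sdiff_null_ae_eq_self (measure_singleton (μ := volume) 0))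
  have hwB : LocallyIntegrableOn w B volume :=
    locallyIntegrableOn_ball (by omega) hw hC hρ hg
  obtain ⟨M, hM0, hM⟩ := exists_bound_of_zero_of_nonpos continuous_glueDeriv
    fun x hx => glueDeriv_of_nonpos hx
  obtain ⟨ME, hME0, hME⟩ := exists_bound_of_zero_of_nonpos
    (expNegInvGlue.contDiff (n := 0)).continuous fun x hx => expNegInvGlue.zero_of_nonpos hx
  set τ : ℕ → EuclideanSpace ℝ (Fin n) → ℝ := fun k x =>
    1 / 2 + Real.log (‖x‖ ^ 2) / (4 * ((k : ℝ) + 1)) with hτ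
  have hτle : ∀ k, ∀ x ∈ B, τ k x ≤ 1 / 2 := by
    intro k x hx
    have h1 : ‖x‖ < 1 := mem_ball_zero_iff.1 hx
    have h2 : Real.log (‖x‖ ^ 2) ≤ 0 :=
      Real.log_nonpos (by positivity) (pow_le_one₀ (norm_nonneg _) h1.le)
    have h3 : Real.log (‖x‖ ^ 2) / (4 * ((k : ℝ) + 1)) ≤ 0 :=
      div_nonpos_of_nonpos_of_nonneg h2 (by positivity)
    simp only [hτ]
    linarith
  -- `G k` is the Laplacian of `φ` times the cutoff, without the term in which both derivatives fall
  -- on the cutoff. That term has a favourable sign but need not have an integrable majorant.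
  set G : ℕ → EuclideanSpace ℝ (Fin n) → ℝ := fun k x =>
    logCutoff ((k : ℝ) + 1) x * (Δ φ) x
      + glueDeriv (τ k x) / (((k : ℝ) + 1) * ‖x‖ ^ 2) * fderiv ℝ φ x x with hG
  have hΔc : Continuous (Δ φ) := continuous_laplacian hφ
  have hDc : Continuous (fderiv ℝ φ) := hφ.continuous_fderiv (by simp)
  have hD0 : ∀ x ∉ tsupport φ, fderiv ℝ φ x = 0 := fun x hx =>
    (fderiv_of_notMem_tsupport (𝕜 := ℝ) hx)
  have hGmeas : ∀ k, Measurable (G k) := by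
    intro k
    have h1 : Measurable (τ k) := by
      simp only [hτ]
      fun_prop
    have h2 : Measurable fun x => fderiv ℝ φ x x := (hDc.clm_apply continuous_id).measurable
    exact ((contDiff_logCutoff (by positivity)).continuous.measurable.mul hΔc.measurable).add
      (((continuous_glueDeriv.measurable.comp h1).div (by fun_prop)).mul h2)
  have hGle : ∀ k, ∀ x ∈ B, |G k x| ≤ ME * |(Δ φ) x| + M * ‖fderiv ℝ φ x‖ * ‖x‖⁻¹ := by
    intro k x hx
    refine (abs_add_le _ _).trans (add_le_add ?_ ?_)
    · rw [abs_mul]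
      gcongr
      unfold logCutoff
      split_ifs
      · simpa using hME0.le
      · exact hME _ ((hτle k x hx).trans (by norm_num))
    · rcases eq_or_ne x 0 with rfl | hx0
      · simp
      have hxp : 0 < ‖x‖ := norm_pos_iff.2 hx0
      rw [abs_mul, abs_div, abs_of_nonneg (by positivity : 0 ≤ ((k : ℝ) + 1) * ‖x‖ ^ 2)]
      have h1 : |glueDeriv (τ k x)| ≤ M := hM _ ((hτle k x hx).trans (by norm_num))
      have h2 : |fderiv ℝ φ x x| ≤ ‖fderiv ℝ φ x‖ * ‖x‖ := (fderiv ℝ φ x).le_opNorm x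
      have h3 : ‖x‖ ^ 2 ≤ ((k : ℝ) + 1) * ‖x‖ ^ 2 :=
        le_mul_of_one_le_left (by positivity) (by linarith [(Nat.cast_nonneg k : (0 : ℝ) ≤ k)])
      calc |glueDeriv (τ k x)| / (((k : ℝ) + 1) * ‖x‖ ^ 2) * |fderiv ℝ φ x x|
          ≤ M / ‖x‖ ^ 2 * (‖fderiv ℝ φ x‖ * ‖x‖) := by gcongr
        _ = _ := by field_simp
  -- A majorant independent of `k`. The gradient of the cutoff costs one factor `1 / |x|`, and `|w|
  -- / |x| = O(|x|^(1-n))` is still integrable near 0.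
  have hbound : Integrable (fun x => |w x| * (ME * |(Δ φ) x| + M * ‖fderiv ℝ φ x‖ * ‖x‖⁻¹))
      (volume.restrict B) := by
    refine IntegrableOn.of_forall_sdiff_eq_zero (s := tsupport φ) ?_ measurableSet_ball
      fun x hx => by
        rw [laplacian_eq_zero_of_notMem_tsupport hx.2, hD0 x hx.2]
        simp
    have h1 : IntegrableOn (fun x => |w x| * (ME * |(Δ φ) x|)) (tsupport φ) :=
      IntegrableOn.mul_continuousOn (hwB.integrableOn_compact_subset hφb hφc).norm
        (continuous_const.mul hΔc.abs).continuousOn hφc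
    have h2 : IntegrableOn (fun x => |w x * ‖x‖⁻¹| * (M * ‖fderiv ℝ φ x‖)) (tsupport φ) :=
      IntegrableOn.mul_continuousOn
        (integrableOn_mul_inv_norm (by omega) hw hC hρ hg hφc hφb).norm
        (continuous_const.mul hDc.norm).continuousOn hφc
    refine (h1.add h2).congr (Eventually.of_forall fun x => ?_)
    simp only [Pi.add_apply, abs_mul, abs_inv, abs_norm]
    ring
  have hGint : ∀ k, Integrable (fun x => w x * G k x) (volume.restrict B) := by
    intro k
    refine hbound.mono' (hwB.aestronglyMeasurable.mul (hGmeas k).aestronglyMeasurable) ?_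
    filter_upwards [ae_restrict_mem measurableSet_ball] with x hx
    rw [norm_mul, Real.norm_eq_abs, Real.norm_eq_abs]
    exact mul_le_mul_of_nonneg_left (hGle k x hx) (abs_nonneg _)
  have hGneg : ∀ k, ∫ x in B, w x * G k x ≤ 0 := by
    intro k
    have hk : (0 : ℝ) < (k : ℝ) + 1 := by positivity
    set f : EuclideanSpace ℝ (Fin n) → ℝ := fun y => φ y * logCutoff ((k : ℝ) + 1) y with hf
    have hfs : ContDiff ℝ ∞ f := hφ.mul (contDiff_logCutoff hk)
    have hfφ : tsupport f ⊆ tsupport φ := tsupport_mul_subset_left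
    have hfc : HasCompactSupport f := hφc.mul_right
    have hfΩ : tsupport f ⊆ B \ {0} := by
      refine fun x hx => ⟨hφb (hfφ hx), ?_⟩
      rintro rfl
      refine notMem_tsupport_iff_eventuallyEq.2 ?_ hx
      filter_upwards [logCutoff_eventuallyEq_zero (n := n) hk] with y hy
      simp [hf, hy]
    have h1 : ∫ x in B, w x * (Δ f) x ≤ 0 := by
      rw [← hres]
      exact hsup f hfs hfc hfΩ fun x => mul_nonneg (hφ0 x) (logCutoff_nonneg _ _)
    refine le_trans (integral_mono_ae (hGint k) ?_ ?_) h1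
    · exact integrableOn_mul_of_tsupport_subset Metric.isOpen_ball hwB (continuous_laplacian hfs)
        hfc (hfφ.trans hφb) fun x hx => laplacian_eq_zero_of_notMem_tsupport hx
    · filter_upwards [hnn, ae_restrict_mem measurableSet_ball,
        ae_restrict_of_ae (Measure.ae_ne volume (0 : EuclideanSpace ℝ (Fin n)))] with x hx hxB hx0
      refine mul_le_mul_of_nonneg_left ?_ hx
      rw [laplacian_mul_logCutoff hφ hk hx0]
      refine le_add_of_nonneg_right (mul_nonneg (hφ0 x) (add_nonneg ?_ ?_))
      · exact div_nonneg (glueDerivTwo_nonneg (hτle k x hxB)) (by positivity)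
      · have : (2 : ℝ) ≤ n := by exact_mod_cast hn
        exact mul_nonneg (by linarith) (div_nonneg (glueDeriv_nonneg _) (by positivity))
  -- As `k → ∞` the cutoffs tend to the positive constant `expNegInvGlue (1 / 2)` off the origin,
  -- and the gradient term is `O(1 / k)` pointwise.
  have hlim : Tendsto (fun k => ∫ x in B, w x * G k x) atTop
      (𝓝 (∫ x in B, w x * (expNegInvGlue (1 / 2) * (Δ φ) x))) := by
    refine tendsto_integral_of_dominated_convergence _ (fun k => (hGint k).aestronglyMeasurable)
      hbound (fun k => ?_) ?_
    · filter_upwards [ae_restrict_mem measurableSet_ball] with x hx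
      rw [norm_mul, Real.norm_eq_abs, Real.norm_eq_abs]
      exact mul_le_mul_of_nonneg_left (hGle k x hx) (abs_nonneg _)
    · filter_upwards [ae_restrict_of_ae
        (Measure.ae_ne volume (0 : EuclideanSpace ℝ (Fin n)))] with x hx0
      have hk : Tendsto (fun k : ℕ => (k : ℝ) + 1) atTop atTop :=
        tendsto_atTop_add_const_right _ _ tendsto_natCast_atTop_atTop
      have h1 : Tendsto (fun k => τ k x) atTop (𝓝 (1 / 2)) := by
        have := (tendsto_const_nhds (x := Real.log (‖x‖ ^ 2))).div_atTop
          (hk.const_mul_atTop (by norm_num : (0 : ℝ) < 4))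
        have h := this.const_add (1 / 2)
        rwa [add_zero] at h
      have h2 : Tendsto (fun k : ℕ => logCutoff ((k : ℝ) + 1) x) atTop
          (𝓝 (expNegInvGlue (1 / 2))) := by
        simp only [logCutoff_of_ne _ hx0]
        exact ((expNegInvGlue.contDiff (n := 0)).continuous.tendsto _).comp h1
      have h3 : Tendsto (fun k : ℕ => glueDeriv (τ k x) / (((k : ℝ) + 1) * ‖x‖ ^ 2)) atTop
          (𝓝 0) :=
        ((continuous_glueDeriv.tendsto _).comp h1).div_atTop
          (hk.atTop_mul_const (by have := norm_pos_iff.2 hx0; positivity))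
      simpa using! ((h2.mul_const ((Δ φ) x)).add (h3.mul_const (fderiv ℝ φ x x))).const_mul (w x)
  have hfin := le_of_tendsto hlim (Eventually.of_forall hGneg)
  have he : ∫ x in B, w x * (expNegInvGlue (1 / 2) * (Δ φ) x) =
      expNegInvGlue (1 / 2) * ∫ x in B, w x * (Δ φ) x := by
    rw [← integral_const_mul]
    refine integral_congr_ae (Eventually.of_forall fun x => ?_)
    ring
  rw [he] at hfin
  exact nonpos_of_mul_nonpos_right hfin (expNegInvGlue.pos_of_pos (by norm_num))

/-! ### Dimension one: concavity, linear growth and the resulting contradiction. -/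

open scoped Convolution in
/-- A weakly concave function on `(0, 1)` has concave smooth approximations. -/
theorem concaveOn_convolution_of_weakly_concave {u : ℝ → ℝ}
    (hu : LocallyIntegrableOn u (Set.Ioo 0 1))
    (hcc : ∀ φ : ℝ → ℝ, ContDiff ℝ ∞ φ → HasCompactSupport φ → tsupport φ ⊆ Set.Ioo 0 1 →
      (∀ s, 0 ≤ φ s) → ∫ s in Set.Ioo 0 1, u s * deriv (deriv φ) s ≤ 0)
    {δ : ℝ} (hδ : 0 < δ) (f : ContDiffBump (0 : ℝ)) :
    ConcaveOn ℝ (Set.Icc (δ + f.rOut) (1 - δ - f.rOut))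
      (f.normed volume ⋆[ContinuousLinearMap.lsmul ℝ ℝ, volume]
        (Set.Icc δ (1 - δ)).indicator u) := by
  have hsub : Set.Icc δ (1 - δ) ⊆ Set.Ioo (0 : ℝ) 1 := fun x hx =>
    ⟨by linarith [hx.1], by linarith [hx.2]⟩
  have hint : Integrable ((Set.Icc δ (1 - δ)).indicator u) :=
    (hu.integrableOn_compact_subset hsub isCompact_Icc).integrable_indicator measurableSet_Icc
  have hf : ContDiff ℝ ∞ (f.normed (volume : Measure ℝ)) := f.contDiff_normed
  have hf' : ContDiff ℝ ∞ (deriv (f.normed (volume : Measure ℝ))) :=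
    (contDiff_infty_iff_deriv.1 hf).2
  have h1 : ∀ x, HasDerivAt (f.normed volume ⋆[ContinuousLinearMap.lsmul ℝ ℝ, volume]
        (Set.Icc δ (1 - δ)).indicator u) _ x := fun x =>
    f.hasCompactSupport_normed.hasDerivAt_convolution_left (ContinuousLinearMap.lsmul ℝ ℝ)
      (hf.of_le (WithTop.coe_le_coe.2 le_top)) hint.locallyIntegrable x
  have h2 : ∀ x, HasDerivAt (deriv (f.normed volume) ⋆[ContinuousLinearMap.lsmul ℝ ℝ, volume]
        (Set.Icc δ (1 - δ)).indicator u) _ x := fun x =>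
    (f.hasCompactSupport_normed (μ := volume)).deriv.hasDerivAt_convolution_left
      (ContinuousLinearMap.lsmul ℝ ℝ)
      (hf'.of_le (WithTop.coe_le_coe.2 le_top)) hint.locallyIntegrable x
  have hd1 := funext fun x => (h1 x).deriv
  refine concaveOn_of_deriv2_nonpos' (convex_Icc _ _)
    (fun x _ => (h1 x).differentiableAt.differentiableWithinAt) ?_ ?_
  · intro x _
    rw [hd1]
    exact (h2 x).differentiableAt.differentiableWithinAt
  intro x hx
  simp only [Function.iterate_succ, Function.iterate_zero, Function.comp, id]
  rw [hd1, (h2 x).deriv, convolution_lsmul_swap]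
  -- The second derivative of the mollification at `x` is `u` tested against `φ''`. The range of `x`
  -- keeps the support of `φ` inside `[δ, 1 - δ]`, where the truncation of `u` is invisible.
  set φ : ℝ → ℝ := fun s => f.normed volume (x - s) with hφ
  have hφd : ∀ s, deriv (deriv φ) s = deriv (deriv (f.normed volume)) (x - s) := by
    intro s
    have e : deriv φ = fun s => -deriv (f.normed volume) (x - s) :=
      funext fun s => deriv_comp_const_sub (f := f.normed volume) x s
    rw [e, deriv.fun_neg, deriv_comp_const_sub (f := deriv (f.normed volume)), neg_neg]
  have hsupp : tsupport φ ⊆ Set.Icc δ (1 - δ) := by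
    refine closure_minimal (fun s hs => ?_) isClosed_Icc
    have : x - s ∈ Function.support (f.normed (volume : Measure ℝ)) := hs
    rw [f.support_normed_eq, mem_ball_zero_iff, Real.norm_eq_abs, abs_lt] at this
    exact ⟨by linarith [hx.1, this.2], by linarith [hx.2, this.1]⟩
  have hφs : ContDiff ℝ ∞ φ := hf.comp (contDiff_const.sub contDiff_id)
  have h0 : ∀ s ∉ Set.Icc δ (1 - δ), deriv (deriv φ) s = 0 := by
    intro s hs
    have h : φ =ᶠ[𝓝 s] fun _ => (0 : ℝ) := notMem_tsupport_iff_eventuallyEq.1 fun h => hs (hsupp h)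
    simpa using h.deriv.deriv_eq
  refine le_of_eq_of_le ?_ (hcc φ hφs (isCompact_Icc.of_isClosed_subset (isClosed_tsupport _) hsupp)
    (hsupp.trans hsub) fun s => f.nonneg_normed _)
  rw [← integral_indicator measurableSet_Ioo]
  refine integral_congr_ae (Eventually.of_forall fun s => ?_)
  simp only [← hφd, smul_eq_mul]
  by_cases hs : s ∈ Set.Icc δ (1 - δ)
  · rw [Set.indicator_of_mem hs, Set.indicator_of_mem (hsub hs), mul_comm]
  · rw [h0 s hs, Set.indicator_of_notMem hs]
    simp [Set.indicator_apply, h0 s hs]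

open scoped Convolution in
-- The concave mollifications converge to `u` almost everywhere. For each of them, compare `x` with
-- the chord from `2δ` to `a` and drop the nonnegative value at `2δ`. The slope ratio `(x - 2δ) / (a
-- - 2δ)` is at least `x / (2a)` once `x > 4δ`, a bound free of `δ`.
theorem ae_le_of_weakly_concave {u : ℝ → ℝ} (hu : LocallyIntegrableOn u (Set.Ioo 0 1))
    (hnn : ∀ᵐ s, s ∈ Set.Ioo (0 : ℝ) 1 → 0 ≤ u s)
    (hcc : ∀ φ : ℝ → ℝ, ContDiff ℝ ∞ φ → HasCompactSupport φ → tsupport φ ⊆ Set.Ioo 0 1 →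
      (∀ s, 0 ≤ φ s) → ∫ s in Set.Ioo 0 1, u s * deriv (deriv φ) s ≤ 0)
    {δ : ℝ} (hδ : 0 < δ) :
    ∃ G : Set ℝ, (∀ᵐ s, s ∈ G) ∧ ∀ x ∈ G, ∀ a ∈ G, 4 * δ < x → x < a → a < 1 - 2 * δ →
      x / (2 * a) * u a ≤ u x := by
  set v : ℕ → ContDiffBump (0 : ℝ) := fun i =>
    ⟨δ / (i + 2) / 2, δ / (i + 2), by positivity, half_lt_self (by positivity)⟩ with hv
  have hsub : Set.Icc δ (1 - δ) ⊆ Set.Ioo (0 : ℝ) 1 := fun x hx =>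
    ⟨by linarith [hx.1], by linarith [hx.2]⟩
  have hint : Integrable ((Set.Icc δ (1 - δ)).indicator u) :=
    (hu.integrableOn_compact_subset hsub isCompact_Icc).integrable_indicator measurableSet_Icc
  have hr0 : Tendsto (fun i => (v i).rOut) atTop (𝓝 0) :=
    tendsto_const_nhds.div_atTop
      (tendsto_atTop_add_const_right _ _ tendsto_natCast_atTop_atTop)
  have hconv := ContDiffBump.ae_convolution_tendsto_right_of_locallyIntegrable (φ := v) (K := 2)
    hr0 (Eventually.of_forall fun i => by simp only [hv]; linarith) hint.locallyIntegrable
  refine ⟨{s | Tendsto (fun i => ((v i).normed volume ⋆[ContinuousLinearMap.lsmul ℝ ℝ, volume]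
      (Set.Icc δ (1 - δ)).indicator u) s) atTop (𝓝 ((Set.Icc δ (1 - δ)).indicator u s))},
    hconv, fun x hx a ha hδx hxa ha1 => ?_⟩
  have hxI : x ∈ Set.Icc δ (1 - δ) := ⟨by linarith, by linarith⟩
  have haI : a ∈ Set.Icc δ (1 - δ) := ⟨by linarith, by linarith⟩
  rw [Set.mem_ofPred_eq, Set.indicator_of_mem hxI] at hx
  rw [Set.mem_ofPred_eq, Set.indicator_of_mem haI] at ha
  refine le_of_tendsto_of_tendsto' (ha.const_mul (x / (2 * a))) hx fun i => ?_
  have hrδ : (v i).rOut ≤ δ := div_le_self hδ.le (by linarith [(Nat.cast_nonneg i : (0 : ℝ) ≤ i)])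
  have hr00 : 0 < (v i).rOut := (v i).rOut_pos
  have hnn' : ∀ y, 0 ≤ ((v i).normed volume ⋆[ContinuousLinearMap.lsmul ℝ ℝ, volume]
      (Set.Icc δ (1 - δ)).indicator u) y := by
    intro y
    rw [convolution_lsmul_swap]
    refine integral_nonneg_of_ae ?_
    filter_upwards [hnn] with s hs
    refine smul_nonneg ((v i).nonneg_normed _) ?_
    by_cases h : s ∈ Set.Icc δ (1 - δ)
    · rw [Set.indicator_of_mem h]; exact hs (hsub h)
    · rw [Set.indicator_of_notMem h]
  have hc := concaveOn_convolution_of_weakly_concave hu hcc hδ (v i)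
  set g := (v i).normed volume ⋆[ContinuousLinearMap.lsmul ℝ ℝ, volume]
      (Set.Icc δ (1 - δ)).indicator u with hg
  have hap : 0 < a - 2 * δ := by linarith
  set θ := (x - 2 * δ) / (a - 2 * δ) with hθ
  have hθ1 : θ ≤ 1 := by rw [hθ, div_le_one hap]; linarith
  have hθ0 : x / (2 * a) ≤ θ := by
    rw [hθ, div_le_div_iff₀ (by linarith) hap]
    nlinarith
  have hθ00 : 0 ≤ θ := div_nonneg (by linarith) hap.le
  have key := hc.2 (x := 2 * δ) ⟨by linarith, by linarith⟩ (y := a) ⟨by linarith, by linarith⟩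
    (sub_nonneg.2 hθ1) hθ00 (by ring)
  have hxe : (1 - θ) • (2 * δ) + θ • a = x := by
    rw [hθ, smul_eq_mul, smul_eq_mul]
    field_simp
    ring
  rw [hxe] at key
  simp only [smul_eq_mul] at key
  calc x / (2 * a) * g a ≤ θ * g a := mul_le_mul_of_nonneg_right hθ0 (hnn' a)
    _ ≤ (1 - θ) * g (2 * δ) + θ * g a :=
      le_add_of_nonneg_left (mul_nonneg (sub_nonneg.2 hθ1) (hnn' _))
    _ ≤ g x := key

/-- A nonnegative weakly concave function on `(0, 1)` either vanishes or grows at least linearly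
at the origin. -/
theorem eq_zero_or_linear_growth_of_weakly_concave {u : ℝ → ℝ}
    (hu : LocallyIntegrableOn u (Set.Ioo 0 1)) (hnn : ∀ᵐ s, s ∈ Set.Ioo (0 : ℝ) 1 → 0 ≤ u s)
    (hcc : ∀ φ : ℝ → ℝ, ContDiff ℝ ∞ φ → HasCompactSupport φ → tsupport φ ⊆ Set.Ioo 0 1 →
      (∀ s, 0 ≤ φ s) → ∫ s in Set.Ioo 0 1, u s * deriv (deriv φ) s ≤ 0) :
    (∀ᵐ s, s ∈ Set.Ioo (0 : ℝ) 1 → u s = 0) ∨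
      ∃ c > 0, ∃ a > 0, ∀ᵐ s, s ∈ Set.Ioo (0 : ℝ) a → c * s ≤ u s := by
  choose G hG hGle using fun m : ℕ => ae_le_of_weakly_concave hu hnn hcc
    (δ := 1 / ((m : ℝ) + 1)) (by positivity)
  -- With one null set discarded for all `δ = 1 / (m + 1)`, a single point `a` with `u a > 0` bounds
  -- `u` below at almost every `x < a`, taking `m` large depending on `x`.
  have hall : ∀ᵐ s, ∀ m, s ∈ G m := ae_all_iff.2 hG
  by_cases h : ∃ a ∈ Set.Ioo (0 : ℝ) 1, (∀ m, a ∈ G m) ∧ 0 < u a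
  · obtain ⟨a, ha, haG, hua⟩ := h
    right
    refine ⟨u a / (2 * a), div_pos hua (by linarith [ha.1]), a, ha.1, ?_⟩
    filter_upwards [hall] with x hx hxa
    obtain ⟨m, hm⟩ := exists_nat_gt (max (4 / x) (2 / (1 - a)))
    have h1 : 4 / x < m := (le_max_left _ _).trans_lt hm
    have h2 : 2 / (1 - a) < m := (le_max_right _ _).trans_lt hm
    rw [div_lt_iff₀ hxa.1] at h1
    rw [div_lt_iff₀ (by linarith [ha.2])] at h2
    have := hGle m x (hx m) a (haG m)
      (by rw [mul_one_div, div_lt_iff₀ (by positivity)]; nlinarith [hxa.1]) hxa.2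
      (by
        have : 2 * (1 / ((m : ℝ) + 1)) < 1 - a := by
          rw [mul_one_div, div_lt_iff₀ (by positivity)]; nlinarith [ha.2]
        linarith)
    calc u a / (2 * a) * x = x / (2 * a) * u a := by ring
      _ ≤ u x := this
  · left
    push Not at h
    filter_upwards [hall, hnn] with s hs hs0 hsI
    exact le_antisymm (h s hsI hs) (hs0 hsI)

theorem laplacian_comp_symm {L : ℝ ≃ₗᵢ[ℝ] EuclideanSpace ℝ (Fin 1)} {φ : ℝ → ℝ}
    (hφ : ContDiff ℝ ∞ φ) (s : ℝ) :
    (Δ (fun x => φ (L.symm x))) (L s) = deriv (deriv φ) s := by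
  set l : EuclideanSpace ℝ (Fin 1) →L[ℝ] ℝ :=
    ((L.symm : EuclideanSpace ℝ (Fin 1) ≃L[ℝ] ℝ) : EuclideanSpace ℝ (Fin 1) →L[ℝ] ℝ) with hl
  have h1 : ∀ y, HasFDerivAt (fun x => φ (L.symm x)) (deriv φ (L.symm y) • l) y := fun y =>
    ((hφ.differentiable (by simp)) _).hasDerivAt.comp_hasFDerivAt y l.hasFDerivAt
  have h2 : HasFDerivAt (fun x => deriv φ (L.symm x)) (deriv (deriv φ) (L.symm (L s)) • l) (L s) :=
    (((contDiff_infty_iff_deriv.1 hφ).2.differentiable (by simp)) _).hasDerivAt.comp_hasFDerivAt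
      (L s) l.hasFDerivAt
  rw [laplacian_eq_sum_of_hasFDerivAt ((OrthonormalBasis.singleton (Fin 1) ℝ).map L)
    (Eventually.of_forall h1) (h2.smul_const l)]
  simp [hl]

/-- The isometry `L` selects one of the two half-lines, which must be treated separately because the
punctured ball is disconnected. -/
theorem eq_zero_or_linear_growth_of_superharmonic {w : EuclideanSpace ℝ (Fin 1) → ℝ}
    (hw : LocallyIntegrableOn w (Metric.ball 0 1 \ {0}) volume)
    (hsup : WeaklySuperharmonicOn w (Metric.ball 0 1 \ {0}))
    (hnn : ∀ᵐ x ∂(volume.restrict (Metric.ball 0 1)), 0 ≤ w x)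
    (L : ℝ ≃ₗᵢ[ℝ] EuclideanSpace ℝ (Fin 1)) :
    (∀ᵐ s, s ∈ Set.Ioo (0 : ℝ) 1 → w (L s) = 0) ∨
      ∃ c > 0, ∃ a > 0, ∀ᵐ s, s ∈ Set.Ioo (0 : ℝ) a → c * s ≤ w (L s) := by
  have hL : MeasurePreserving L := L.measurePreserving
  have hLe : MeasurableEmbedding L := L.toHomeomorph.measurableEmbedding
  have hΩ : Set.Ioo (0 : ℝ) 1 ⊆ L ⁻¹' (Metric.ball 0 1 \ {0}) := by
    intro s hs
    refine ⟨?_, ?_⟩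
    · rw [mem_ball_zero_iff, L.norm_map, Real.norm_eq_abs, abs_of_pos hs.1]
      exact hs.2
    · simpa using hs.1.ne'
  refine eq_zero_or_linear_growth_of_weakly_concave (u := fun s => w (L s)) ?_ ?_ ?_
  · refine (locallyIntegrableOn_iff isOpen_Ioo.isLocallyClosed).2 fun K hKI hK => ?_
    have h1 : IntegrableOn w (L '' K) := hw.integrableOn_compact_subset
      (Set.image_subset_iff.2 (hKI.trans hΩ)) (hK.image L.continuous)
    have h2 := (hL.integrableOn_comp_preimage hLe).2 h1
    rwa [Set.preimage_image_eq _ L.injective] at h2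
  · have h1 := hL.quasiMeasurePreserving.ae ((ae_restrict_iff' measurableSet_ball).1 hnn)
    filter_upwards [h1] with s hs hsI
    exact hs (hΩ hsI).1
  · intro φ hφ hφc hφI hφ0
    have hts : tsupport (fun x => φ (L.symm x)) ⊆ L '' tsupport φ := by
      refine closure_minimal (fun x hx => ⟨L.symm x, subset_tsupport _ hx, by simp⟩) ?_
      exact (hφc.isCompact.image L.continuous).isClosed
    have h1 := hsup (fun x => φ (L.symm x))
      (hφ.comp L.symm.contDiff)
      ((hφc.isCompact.image L.continuous).of_isClosed_subset (isClosed_tsupport _) hts)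
      (hts.trans (Set.image_subset_iff.2 (hφI.trans hΩ))) (fun x => hφ0 _)
    rw [← hL.setIntegral_preimage_emb hLe] at h1
    refine le_of_eq_of_le ?_ h1
    rw [setIntegral_eq_of_subset_of_forall_sdiff_eq_zero
      (L.continuous.measurable (isOpen_puncturedBall 1).measurableSet) hΩ]
    · simp only [laplacian_comp_symm hφ]
    · intro s hs
      rw [laplacian_comp_symm hφ]
      have h : φ =ᶠ[𝓝 s] fun _ => (0 : ℝ) :=
        notMem_tsupport_iff_eventuallyEq.1 fun h => hs.2 (hφI h)
      have : deriv (deriv φ) s = 0 := by simpa using h.deriv.deriv_eq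
      rw [this, mul_zero]

theorem lintegral_inv_Ioo_eq_top {a : ℝ} (ha : 0 < a) :
    ∫⁻ s in Set.Ioo 0 a, ENNReal.ofReal s⁻¹ = ⊤ := by
  by_contra h
  have hint : IntegrableOn (fun s : ℝ => s⁻¹) (Set.Ioo 0 a) := by
    refine ⟨measurable_inv.aestronglyMeasurable, ?_⟩
    rw [hasFiniteIntegral_iff_ofReal]
    · exact lt_top_iff_ne_top.2 h
    · filter_upwards [ae_restrict_mem measurableSet_Ioo] with s hs
      exact inv_nonneg.2 hs.1.le
  have h2 : IntervalIntegrable (fun s : ℝ => s⁻¹) volume 0 a :=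
    (intervalIntegrable_iff_integrableOn_Ioo_of_le ha.le).2 hint
  rcases intervalIntegrable_inv_iff.1 h2 with h3 | h3
  · exact ha.ne h3
  · exact h3 Set.left_mem_uIcc

/-- Bounded functions are integrable on compact sets, and local integrability passes measurability
from compact subsets to all of `U`. -/
theorem MemLinftyLoc.aestronglyMeasurable {n : ℕ} {W : EuclideanSpace ℝ (Fin n) → ℝ}
    {U : Set (EuclideanSpace ℝ (Fin n))} (hU : IsOpen U) (hW : MemLinftyLoc W U) :
    AEStronglyMeasurable W (volume.restrict U) := by
  have : LocallyIntegrableOn W U volume :=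
    (locallyIntegrableOn_iff hU.isLocallyClosed).2 fun K hKU hK => by
      have : IsFiniteMeasure (volume.restrict K) := ⟨by simpa using hK.measure_lt_top⟩
      exact (hW K hKU hK).integrable le_top
  exact this.aestronglyMeasurable

/-- The one-dimensional case on a half-line: linear growth of the solution is incompatible with
the integrability of `W w` and of `1 / (|x|^3 W)`. -/
theorem not_linear_growth {W w : EuclideanSpace ℝ (Fin 1) → ℝ}
    (hW : MemLinftyLoc W (Metric.ball 0 1 \ {0}))
    (hW0 : ∀ᵐ x ∂(volume.restrict (Metric.ball 0 1)), 0 ≤ W x)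
    {r : ℝ} (hr : 0 < r)
    (hinv : ∫⁻ x in Metric.ball (0 : EuclideanSpace ℝ (Fin 1)) r,
      (ENNReal.ofReal (‖x‖ ^ 3 * W x))⁻¹ < ⊤)
    (hw : LocallyIntegrableOn w (Metric.ball 0 1 \ {0}) volume)
    (hWw : ∫⁻ x in Metric.ball 0 (1 / 2) \ {0}, ENNReal.ofReal (W x * w x) < ⊤)
    (L : ℝ ≃ₗᵢ[ℝ] EuclideanSpace ℝ (Fin 1)) {c a : ℝ} (hc : 0 < c) (ha : 0 < a)
    (hg : ∀ᵐ s, s ∈ Set.Ioo (0 : ℝ) a → c * s ≤ w (L s)) : False := by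
  have hL : MeasurePreserving L := L.measurePreserving
  have hLe : MeasurableEmbedding L := L.toHomeomorph.measurableEmbedding
  set b := min a (min r (1 / 2)) with hb
  have hb0 : 0 < b := lt_min ha (lt_min hr (by norm_num))
  have hb1 : b ≤ 1 / 2 := (min_le_right _ _).trans (min_le_right _ _)
  have hbr : b ≤ r := (min_le_right _ _).trans (min_le_left _ _)
  set S := Metric.ball (0 : EuclideanSpace ℝ (Fin 1)) b \ {0} with hS
  have hSΩ : S ⊆ Metric.ball 0 1 \ {0} :=
    Set.sdiff_subset_sdiff_left (Metric.ball_subset_ball (by linarith))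
  have hfin : ∫⁻ x in S, (ENNReal.ofReal c⁻¹ * ENNReal.ofReal (W x * w x)
      + (ENNReal.ofReal (‖x‖ ^ 3 * W x))⁻¹) < ⊤ := by
    have hm : AEMeasurable (fun x => ENNReal.ofReal (W x * w x)) (volume.restrict S) := by
      refine AEMeasurable.mono_measure ?_ (Measure.restrict_mono hSΩ le_rfl)
      exact ((hW.aestronglyMeasurable (isOpen_puncturedBall 1)).mul
        hw.aestronglyMeasurable).aemeasurable.ennreal_ofReal
    rw [lintegral_add_left' (hm.const_mul _), lintegral_const_mul'' _ hm]
    refine ENNReal.add_lt_top.2 ⟨ENNReal.mul_lt_top ENNReal.ofReal_lt_top ?_, ?_⟩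
    · exact (lintegral_mono_set
        (Set.sdiff_subset_sdiff_left (Metric.ball_subset_ball hb1))).trans_lt hWw
    · exact (lintegral_mono_set
        (Set.sdiff_subset.trans (Metric.ball_subset_ball hbr))).trans_lt hinv
  rw [← hL.setLIntegral_comp_preimage_emb hLe] at hfin
  refine hfin.ne (top_le_iff.1 ?_)
  rw [← lintegral_inv_Ioo_eq_top hb0]
  have hsub : Set.Ioo 0 b ⊆ L ⁻¹' S := by
    intro s hs
    refine ⟨?_, ?_⟩
    · rw [mem_ball_zero_iff, L.norm_map, Real.norm_eq_abs, abs_of_pos hs.1]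
      exact hs.2
    · simpa using hs.1.ne'
  refine le_trans (setLIntegral_mono_ae' measurableSet_Ioo ?_) (lintegral_mono_set hsub)
  have h1 := hL.quasiMeasurePreserving.ae ((ae_restrict_iff' measurableSet_ball).1 hW0)
  filter_upwards [hg, h1] with s hs hWs hsI
  have hs0 : 0 < s := hsI.1
  have hwL := hs ⟨hs0, hsI.2.trans_le (min_le_left _ _)⟩
  have hWL : 0 ≤ W (L s) := hWs (hSΩ (hsub hsI)).1
  rw [L.norm_map, Real.norm_eq_abs, abs_of_pos hs0]
  rcases hWL.eq_or_lt with h0 | h0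
  -- Where `W` vanishes, the second summand is `0⁻¹ = ⊤`.
  · rw [← h0]; simp
  rw [← ENNReal.ofReal_mul (by positivity), ← ENNReal.ofReal_inv_of_pos (by positivity),
    ← ENNReal.ofReal_add (mul_nonneg (by positivity)
      (mul_nonneg hWL (le_trans (by positivity) hwL))) (by positivity)]
  refine ENNReal.ofReal_le_ofReal ?_
  have h2 : W (L s) * s ≤ c⁻¹ * (W (L s) * w (L s)) := by
    rw [le_inv_mul_iff₀ hc]
    calc c * (W (L s) * s) = W (L s) * (c * s) := by ring
      _ ≤ _ := mul_le_mul_of_nonneg_left hwL hWL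
  refine le_trans ?_ (add_le_add_left h2 _)
  -- With `q = s² W`, this is `q + 1 / q ≥ 1` divided by `s`, proved by completing the square in `q²
  -- - q + 1`.
  have e : W (L s) * s + (s ^ 3 * W (L s))⁻¹ - s⁻¹ =
      ((W (L s) * s ^ 2 - 1 / 2) ^ 2 + 3 / 4) * (s ^ 3 * W (L s))⁻¹ := by
    field_simp
    ring
  have : 0 ≤ ((W (L s) * s ^ 2 - 1 / 2) ^ 2 + 3 / 4) * (s ^ 3 * W (L s))⁻¹ := by positivity
  linarith

/-! ### Reduction to nonnegative solutions and conclusion. -/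

theorem exists_growth_bound {n : ℕ} {w : EuclideanSpace ℝ (Fin n) → ℝ} (hn : 1 ≤ n)
    (h : w =O[𝓝 0 ⊓ ae volume] fun x => ‖x‖ ^ (2 - (n : ℤ))) :
    ∃ C > 0, ∃ ρ > 0, ∀ᵐ x : EuclideanSpace ℝ (Fin n), x ∈ Metric.ball 0 ρ →
      |w x| ≤ C * (‖x‖ ^ 2 / ‖x‖ ^ n) := by
  have : Nonempty (Fin n) := ⟨⟨0, hn⟩⟩
  obtain ⟨C, hC, hb⟩ := h.exists_pos
  rw [Asymptotics.isBigOWith_iff, eventually_inf] at hb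
  obtain ⟨s, hs, t, ht, hst⟩ := hb
  obtain ⟨ρ, hρ, hρs⟩ := Metric.mem_nhds_iff.1 hs
  refine ⟨C, hC, ρ, hρ, ?_⟩
  filter_upwards [ht, Measure.ae_ne volume (0 : EuclideanSpace ℝ (Fin n))] with x hxt hx0 hxρ
  have hx := hst x ⟨hρs hxρ, hxt⟩
  have hne : ‖x‖ ≠ 0 := norm_ne_zero_iff.2 hx0
  rw [Real.norm_eq_abs, Real.norm_of_nonneg (by positivity), zpow_sub₀ hne] at hx
  exact_mod_cast hx

theorem IsWeakSolution.neg {n : ℕ} {W w : EuclideanSpace ℝ (Fin n) → ℝ}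
    {U : Set (EuclideanSpace ℝ (Fin n))} (h : IsWeakSolution W w U) :
    IsWeakSolution W (fun x => -w x) U := by
  intro φ hφ hφc hφU
  have := congrArg Neg.neg (h φ hφ hφc hφU)
  rw [← integral_neg, ← integral_neg] at this
  simpa only [neg_mul, mul_neg] using this

theorem IsWeakSolution.eq_zero_of_nonneg {n : ℕ} (hn : 1 ≤ n)
    {W w : EuclideanSpace ℝ (Fin n) → ℝ} (hw_sol : IsWeakSolution W w (Metric.ball 0 1 \ {0}))
    (hW_loc : MemLinftyLoc W (Metric.ball 0 1 \ {0}))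
    (hW_nonneg : ∀ᵐ x ∂(volume.restrict (Metric.ball (0 : EuclideanSpace ℝ (Fin n)) 1)), 0 ≤ W x)
    (hW_not_L1 : ¬ IntegrableAtFilter W (𝓝 0) volume)
    (hW_inv : ∃ r : ℝ, 0 < r ∧
      ∫⁻ x in Metric.ball (0 : EuclideanSpace ℝ (Fin n)) r,
        (ENNReal.ofReal (‖x‖ ^ (n + 2) * W x))⁻¹ < ⊤)
    (hw_loc : LocallyIntegrableOn w (Metric.ball 0 1 \ {0}) volume)
    {C ρ : ℝ} (hC : 0 < C) (hρ : 0 < ρ)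
    (hg : ∀ᵐ x : EuclideanSpace ℝ (Fin n), x ∈ Metric.ball 0 ρ →
      |w x| ≤ C * (‖x‖ ^ 2 / ‖x‖ ^ n))
    (hnn : ∀ᵐ x ∂(volume.restrict (Metric.ball (0 : EuclideanSpace ℝ (Fin n)) 1)), 0 ≤ w x) :
    ∀ᵐ x ∂(volume.restrict (Metric.ball (0 : EuclideanSpace ℝ (Fin n)) 1)), w x = 0 := by
  have : Nonempty (Fin n) := ⟨⟨0, hn⟩⟩
  have hWwB : ∀ᵐ x ∂(volume.restrict (Metric.ball (0 : EuclideanSpace ℝ (Fin n)) 1)),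
      0 ≤ W x * w x := by
    filter_upwards [hW_nonneg, hnn] with x h1 h2 using mul_nonneg h1 h2
  have hWw := ae_restrict_of_ae_restrict_of_subset
    (Set.sdiff_subset : Metric.ball (0 : EuclideanSpace ℝ (Fin n)) 1 \ {0} ⊆ _) hWwB
  have hfin := hw_sol.lintegral_potential_mul_lt_top hW_loc hw_loc hWw hC hρ hg
  have hsup := hw_sol.weaklySuperharmonicOn hWw
  rcases hn.eq_or_lt with rfl | hn2
  · obtain ⟨r, hr, hinv⟩ := hW_inv
    have hline : ∀ L : ℝ ≃ₗᵢ[ℝ] EuclideanSpace ℝ (Fin 1),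
        ∀ᵐ s, s ∈ Set.Ioo (0 : ℝ) 1 → w (L s) = 0 := by
      intro L
      rcases eq_zero_or_linear_growth_of_superharmonic hw_loc hsup hnn L with
        h | ⟨c, hc, a, ha, h⟩
      · exact h
      · exact (not_linear_growth hW_loc hW_nonneg hr hinv hw_loc hfin L hc ha h).elim
    set L : ℝ ≃ₗᵢ[ℝ] EuclideanSpace ℝ (Fin 1) := (OrthonormalBasis.singleton (Fin 1) ℝ).repr
    have h1 := L.symm.measurePreserving.quasiMeasurePreserving.ae (hline L)
    -- The reflected isometry covers the other half-line; the origin is a null set.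
    set L' := (LinearIsometryEquiv.neg ℝ).trans L with hL'
    have h2 := L'.symm.measurePreserving.quasiMeasurePreserving.ae (hline L')
    rw [ae_restrict_iff' measurableSet_ball]
    filter_upwards [h1, h2, Measure.ae_ne volume (0 : EuclideanSpace ℝ (Fin 1))] with x hx1 hx2 hx0 hxB
    have hs : |L.symm x| < 1 := by
      rw [← Real.norm_eq_abs, L.symm.norm_map]
      exact mem_ball_zero_iff.1 hxB
    have hs0 : L.symm x ≠ 0 := by simpa using hx0
    have hs' : L'.symm x = -L.symm x := by
      rw [LinearIsometryEquiv.symm_apply_eq]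
      simp [hL']
    rcases lt_or_gt_of_ne hs0 with h | h
    · simpa using hx2 (by rw [hs']; exact ⟨by linarith, by linarith [(abs_lt.1 hs).1]⟩)
    · simpa using hx1 ⟨h, (abs_lt.1 hs).2⟩
  · have hsupB := hsup.removable_singularity hn2 hw_loc hnn hC hρ hg
    rcases hsupB.strong_minimum_principle Metric.isOpen_ball
      (convex_ball (0 : EuclideanSpace ℝ (Fin n)) 1).isPreconnected
      (locallyIntegrableOn_ball hn hw_loc hC hρ hg) hnn with h | h
    · exact h
    · exfalso
      obtain ⟨δ, hδ, c, hc, hcw⟩ := h 0 (Metric.mem_ball_self one_pos)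
      set b := min δ (1 / 2) with hb
      have hb0 : 0 < b := lt_min hδ (by norm_num)
      have hb1 : b ≤ 1 / 2 := min_le_right _ _
      refine hW_not_L1 ⟨_, Metric.ball_mem_nhds 0 hb0, ?_⟩
      have hres : volume.restrict (Metric.ball (0 : EuclideanSpace ℝ (Fin n)) b \ {0}) =
          volume.restrict (Metric.ball 0 b) :=
        Measure.restrict_congr_set (sdiff_null_ae_eq_self (measure_singleton (μ := volume) 0))
      have hS : Metric.ball (0 : EuclideanSpace ℝ (Fin n)) b \ {0} ⊆ Metric.ball 0 1 \ {0} :=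
        Set.sdiff_subset_sdiff_left (Metric.ball_subset_ball (by linarith))
      rw [IntegrableOn, ← hres]
      have hW0 := ae_restrict_of_ae_restrict_of_subset (hS.trans Set.sdiff_subset) hW_nonneg
      have hcw' := ae_restrict_of_ae_restrict_of_subset
        (Set.sdiff_subset.trans (Metric.ball_subset_ball (min_le_left δ (1 / 2))) :
          Metric.ball (0 : EuclideanSpace ℝ (Fin n)) b \ {0} ⊆ _) hcw
      refine ⟨(hW_loc.aestronglyMeasurable (isOpen_puncturedBall n)).mono_measure
        (Measure.restrict_mono hS le_rfl), ?_⟩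
      rw [hasFiniteIntegral_iff_ofReal hW0]
      -- Since `w ≥ c` here, `W ≤ c⁻¹ W w`, and the right-hand side is integrable near 0.
      calc ∫⁻ x in Metric.ball 0 b \ {0}, ENNReal.ofReal (W x)
          ≤ ∫⁻ x in Metric.ball 0 b \ {0}, ENNReal.ofReal c⁻¹ * ENNReal.ofReal (W x * w x) := by
            refine lintegral_mono_ae ?_
            filter_upwards [hW0, hcw'] with x h1 h2
            rw [← ENNReal.ofReal_mul (by positivity)]
            refine ENNReal.ofReal_le_ofReal ?_
            rw [le_inv_mul_iff₀ hc, mul_comm]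
            exact mul_le_mul_of_nonneg_left h2 h1
        _ = ENNReal.ofReal c⁻¹ * ∫⁻ x in Metric.ball 0 b \ {0}, ENNReal.ofReal (W x * w x) :=
            lintegral_const_mul' _ _ ENNReal.ofReal_ne_top
        _ < ⊤ := ENNReal.mul_lt_top ENNReal.ofReal_lt_top ((lintegral_mono_set
            (Set.sdiff_subset_sdiff_left (Metric.ball_subset_ball hb1))).trans_lt hfin)

theorem theorem4p1 (n : ℕ) (hn : 1 ≤ n) (W w : EuclideanSpace ℝ (Fin n) → ℝ)
    -- the potential
    (hW_loc : MemLinftyLoc W (Metric.ball 0 1 \ {0}))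
    (hW_nonneg : ∀ᵐ x ∂(volume.restrict (Metric.ball (0 : EuclideanSpace ℝ (Fin n)) 1)), 0 ≤ W x)
    (hW_not_L1 : ¬ IntegrableAtFilter W (𝓝 0) volume)
    -- `1 / (|x|^(n+2) W)` is integrable near `0`, its value being `∞` where `W` vanishes
    (hW_inv : ∃ r : ℝ, 0 < r ∧
      ∫⁻ x in Metric.ball (0 : EuclideanSpace ℝ (Fin n)) r,
        (ENNReal.ofReal (‖x‖ ^ (n + 2) * W x))⁻¹ < ⊤)
    -- the solution
    (hw_loc : LocallyIntegrableOn w (Metric.ball 0 1 \ {0}) volume)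
    (hw_sol : IsWeakSolution W w (Metric.ball 0 1 \ {0}))
    -- `w = O(|x|^(2-n))` near `0`, up to null sets
    (hw_growth : w =O[𝓝 0 ⊓ ae volume] fun x => ‖x‖ ^ (2 - (n : ℤ)))
    (hw_sign :
      (∀ᵐ x ∂(volume.restrict (Metric.ball (0 : EuclideanSpace ℝ (Fin n)) 1)), 0 ≤ w x) ∨
      (∀ᵐ x ∂(volume.restrict (Metric.ball (0 : EuclideanSpace ℝ (Fin n)) 1)), w x ≤ 0)) :
    ∀ᵐ x ∂(volume.restrict (Metric.ball (0 : EuclideanSpace ℝ (Fin n)) 1)), w x = 0 := by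
  have : Nonempty (Fin n) := ⟨⟨0, hn⟩⟩
  obtain ⟨C, hC, ρ, hρ, hg⟩ := exists_growth_bound hn hw_growth
  rcases hw_sign with hnn | hnp
  · exact hw_sol.eq_zero_of_nonneg hn hW_loc hW_nonneg hW_not_L1 hW_inv hw_loc hC hρ hg hnn
  · have hneg := hw_sol.neg.eq_zero_of_nonneg hn hW_loc hW_nonneg
      hW_not_L1 hW_inv hw_loc.neg hC hρ (by simpa only [abs_neg] using hg)
      (by filter_upwards [hnp] with x hx using neg_nonneg.2 hx)
    filter_upwards [hneg] with x hx using neg_eq_zero.1 hx
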